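/- **Proposition 4.5 (a "weak" Poincaré-type inequality).** Write $z=(x,y,t)$, $\zeta=(\xi,\eta,\tau)$ for points of $\mathbb R^3$ and $B_\rho^-=\{|x|<\rho^3,\ |y|<\rho,\ -\rho^2<t<0\}$. *Subsolutions.* Let $\Lambda>0$ and let $a$ be measurable with $\Lambda^{-1}\le a\le\Lambda$ a.e. on $\Omega:=B_1^-$. A function $w$ is a weak subsolution of $\partial_t w-\partial_y(a\,\partial_y w)+y\,\partial_x w=0$ in $\Omega$ if $w\in BV(\Omega)\cap L^\infty_{loc}(\Omega)$, the weak derivative $\partial_y w$ lies in $L^2_{loc}(\Omega)$, there is a constant $K$ with $$\int_\Omega(\partial_t w+y\,\partial_x w)\varphi\le K\big(\|\partial_y\varphi\|_{L^2(\Omega)}+\|\varphi\|_{L^2(\Omega)}\big)\quad\text{for all } 0\le\varphi\in C_0^\infty(\Omega),$$ and $$-\int_\Omega\big(a\,\partial_y\varphi\,\partial_y w+(\partial_t w+y\,\partial_x w)\varphi\big)\,dz\ge0\quad\text{for all } 0\le\varphi\in C_0^\infty(\Omega).$$ Here $\int_\Omega(\partial_t w+y\,\partial_xw)\varphi=-\int_\Omega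 w(\partial_t\varphi+y\,\partial_x\varphi)\,dz$. *Kernel.* For $t>\tau$ let $$\Gamma_0(z,\zeta)=\frac{\sqrt3}{2\pi(t-\tau)^2}\exp\Big\{-\frac{(y-\eta)^2}{4(t-\tau)}-\frac{3}{(t-\tau)^3}\Big(x-\xi-\frac{t-\tau}{2}(y+\eta)\Big)^2\Big\},$$ and let $\Gamma_0(z,\zeta)=0$ for $t\le\tau$; this is the fundamental solution of $\partial_t-\partial_y^2+y\,\partial_x$. *Cut-off.* Let $0<\theta<2^{-6}$ and $0<r<\theta$, and let $\chi\in C^\infty([0,\infty))$ satisfy $0<\chi\le1$ on $[0,r)$, $\chi=0$ on $(r,\infty)$, $\chi=1$ on $[0,\theta^{1/6}r]$, $0\le-\chi'\le\frac{2}{(1-\theta^{1/6})r}$, $|\chi''|\le M r^{-2}$, and $|\chi'|\ge m(\beta_1,\beta_2)r^{-1}>0$ on $[\beta_1r,\beta_2r]$ whenever $\theta^{1/6}<\beta_1<\beta_2<1$, for some constants $M$ and $m(\beta_1,\beta_2)$. For $t\le0$ put $$\phi(x,y,t)=\chi\big([\theta^2x^2-6tr^4]^{1/6}\big)\,\chi(\theta|y|).$$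 *Claim.* There is a constant $C>0$ depending only on $\Lambda$ (not on $\theta,r,\chi,M,m,a,w$) such that, for all $\theta,r,\chi,a$ as above and every weak subsolution $w$ in $B_1^-$ with $w\ge0$ a.e., $$\int_{B^-_{\theta r}}\big|(w(z)-I_0)^+\big|^2dz\le C\theta^2r^2\int_{B^-_{r/\theta}}|\partial_yw(z)|^2dz,$$ where $I_0=\sup_{z\in B^-_{\theta r}}I_1(z)\in(-\infty,+\infty]$ and $$I_1(z)=\int_{B^-_{r/\theta}}\partial_\eta\phi(\zeta)\,\partial_\eta\Gamma_0(z,\zeta)\,w(\zeta)\,d\zeta+\int_{B^-_{r/\theta}}\Gamma_0(z,\zeta)\big(\partial_\tau\phi(\zeta)+\eta\,\partial_\xi\phi(\zeta)\big)w(\zeta)\,d\zeta.$$ The right-hand integral may be $+\infty$, and $(w-I_0)^+=0$ if $I_0=+\infty$. -/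

import Mathlib

open MeasureTheory
open scoped ContDiff ENNReal

noncomputable section

namespace UltraParabolic

/-- Points `z = (x, y, t)` (or `ζ = (ξ, η, τ)`), with Lebesgue measure. -/
abbrev Pt : Type := ℝ × ℝ × ℝ

/-- The partial derivative in the first variable `x`. -/
def dX (f : Pt → ℝ) (z : Pt) : ℝ := deriv (fun s => f (s, z.2.1, z.2.2)) z.1

/-- The partial derivative in the second variable `y`. -/
def dY (f : Pt → ℝ) (z : Pt) : ℝ := deriv (fun s => f (z.1, s, z.2.2)) z.2.1

/-- The partial derivative in the third variable `t`. -/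
def dT (f : Pt → ℝ) (z : Pt) : ℝ := deriv (fun s => f (z.1, z.2.1, s)) z.2.2

/-- `B_r^- = {|x| < r³, |y| < r, -r² < t < 0}`. -/
def Bminus (r : ℝ) : Set Pt :=
  {z | |z.1| < r ^ 3 ∧ |z.2.1| < r ∧ -r ^ 2 < z.2.2 ∧ z.2.2 < 0}

/-- `φ ∈ C₀^∞(Ω)`. -/
def IsTest (Ω : Set Pt) (φ : Pt → ℝ) : Prop :=
  ContDiff ℝ ∞ φ ∧ HasCompactSupport φ ∧ tsupport φ ⊆ Ω

/-- `g` is the weak derivative `∂_y u` in `Ω`. -/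
def HasWeakDY (Ω : Set Pt) (u g : Pt → ℝ) : Prop :=
  ∀ φ, IsTest Ω φ → ∫ z in Ω, u z * dY φ z = - ∫ z in Ω, g z * φ z

/-- `u ∈ L^p_loc(Ω)`. -/
def LpLoc (p : ℝ≥0∞) (Ω : Set Pt) (u : Pt → ℝ) : Prop :=
  ∀ K : Set Pt, IsCompact K → K ⊆ Ω → MemLp u p (volume.restrict K)

/-- `u ∈ BV(Ω)`: `u` is integrable and its total variation
`sup {∫_Ω u div Φ : Φ ∈ C₀^∞(Ω; ℝ³), |Φ| ≤ 1}` is finite. -/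
def IsBV (Ω : Set Pt) (u : Pt → ℝ) : Prop :=
  IntegrableOn u Ω ∧
  ∃ K : ℝ, ∀ φ₁ φ₂ φ₃, IsTest Ω φ₁ → IsTest Ω φ₂ → IsTest Ω φ₃ →
    (∀ z, φ₁ z ^ 2 + φ₂ z ^ 2 + φ₃ z ^ 2 ≤ 1) →
    ∫ z in Ω, u z * (dX φ₁ z + dY φ₂ z + dT φ₃ z) ≤ K

/-- The pairing `∫_Ω (∂_t u + y ∂_x u) φ` of the derivatives of `u` (measures when `u` is of
bounded variation) with a test function, by definition of the distributional derivatives; note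
that `y` commutes with `∂_x`. -/
def transport (Ω : Set Pt) (u φ : Pt → ℝ) : ℝ :=
  - ∫ z in Ω, u z * (dT φ z + z.2.1 * dX φ z)

/-- `∂_t u + y ∂_x u ∈ L²₊(Ω_{x,t}; H_y^{-1})`: `u` is of bounded variation, and the quotients
`∫ (∂_t u + y ∂_x u) φ / (‖∂_y φ‖_{L²} + ‖φ‖_{L²})` over nonnegative test functions are bounded
above. -/
def TransportL2Plus (Ω : Set Pt) (u : Pt → ℝ) : Prop :=
  IsBV Ω u ∧
  ∃ K : ℝ, ∀ φ, IsTest Ω φ → (∀ z, 0 ≤ φ z) →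
    transport Ω u φ ≤
      K * (Real.sqrt (∫ z in Ω, dY φ z ^ 2) + Real.sqrt (∫ z in Ω, φ z ^ 2))

/-- `u`, with weak derivative `uy = ∂_y u`, is a weak subsolution of
`∂_t u - ∂_y (a ∂_y u) + y ∂_x u = 0` in `Ω`. -/
structure IsWeakSubsolution (a : Pt → ℝ) (Ω : Set Pt) (u uy : Pt → ℝ) : Prop where
  transport_mem : TransportL2Plus Ω u
  weakDY : HasWeakDY Ω u uy
  dy_L2loc : LpLoc 2 Ω uy
  bounded_loc : LpLoc ∞ Ω u
  ineq : ∀ φ, IsTest Ω φ → (∀ z, 0 ≤ φ z) →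
    0 ≤ - ((∫ z in Ω, a z * dY φ z * uy z) + transport Ω u φ)

/-- The Kolmogorov kernel `Γ₀(z, ζ)`, the fundamental solution of `∂_t - ∂_y² + y ∂_x`. -/
def Γ₀ (z ζ : Pt) : ℝ :=
  if ζ.2.2 < z.2.2 then
    Real.sqrt 3 / (2 * Real.pi * (z.2.2 - ζ.2.2) ^ 2) *
      Real.exp (- (z.2.1 - ζ.2.1) ^ 2 / (4 * (z.2.2 - ζ.2.2))
        - 3 / (z.2.2 - ζ.2.2) ^ 3 *
          (z.1 - ζ.1 - (z.2.2 - ζ.2.2) / 2 * (z.2.1 + ζ.2.1)) ^ 2)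
  else 0

/-- The admissible cut-off profiles `χ ∈ C^∞([0,∞))` at scale `r`, with the constants `M` and
`m β₁ β₂ > 0` in the bounds on `χ''` and `χ'`. (The derivatives at the end point `s = 0` are
all zero, because `χ` is constant on `[0, θ^{1/6} r]`.) -/
structure IsCutoff (θ r M : ℝ) (m : ℝ → ℝ → ℝ) (χ : ℝ → ℝ) : Prop where
  smooth : ContDiffOn ℝ ∞ χ (Set.Ici 0)
  pos_le_one : ∀ s, 0 ≤ s → s < r → 0 < χ s ∧ χ s ≤ 1
  eq_zero : ∀ s, r < s → χ s = 0
  eq_one : ∀ s, 0 ≤ s → s ≤ θ ^ ((1 : ℝ) / 6) * r → χ s = 1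
  deriv_bound : ∀ s, 0 < s →
    0 ≤ - deriv χ s ∧ - deriv χ s ≤ 2 / ((1 - θ ^ ((1 : ℝ) / 6)) * r)
  deriv2_bound : ∀ s, 0 < s → |deriv (deriv χ) s| ≤ M / r ^ 2
  deriv_lower : ∀ β₁ β₂, θ ^ ((1 : ℝ) / 6) < β₁ → β₁ < β₂ → β₂ < 1 →
    0 < m β₁ β₂ ∧ ∀ s, β₁ * r ≤ s → s ≤ β₂ * r → m β₁ β₂ / r ≤ |deriv χ s|

/-- `φ(x,y,t) = χ((θ² x² - 6 t r⁴)^{1/6}) χ(θ |y|)`; only `t ≤ 0` is relevant. -/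
def cutoff (θ r : ℝ) (χ : ℝ → ℝ) (z : Pt) : ℝ :=
  χ ((θ ^ 2 * z.1 ^ 2 - 6 * z.2.2 * r ^ 4) ^ ((1 : ℝ) / 6)) * χ (θ * |z.2.1|)

/-- `I₁(z) = ∫ ∂_η φ ∂_η Γ₀(z,ζ) w dζ + ∫ Γ₀(z,ζ) (∂_τ φ + η ∂_ξ φ) w dζ` over `B_{r/θ}^-`. -/
def I₁ (θ r : ℝ) (χ : ℝ → ℝ) (w : Pt → ℝ) (z : Pt) : ℝ :=
  (∫ ζ in Bminus (r / θ), dY (cutoff θ r χ) ζ * dY (Γ₀ z) ζ * w ζ) +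
  ∫ ζ in Bminus (r / θ),
    Γ₀ z ζ * (dT (cutoff θ r χ) ζ + ζ.2.1 * dX (cutoff θ r χ) ζ) * w ζ

/-- `I₀ = sup_{B_{θ r}^-} I₁`, a supremum in the extended reals (it may be `+∞`). -/
def I₀ (θ r : ℝ) (χ : ℝ → ℝ) (w : Pt → ℝ) : EReal :=
  ⨆ z ∈ Bminus (θ * r), (I₁ θ r χ w z : EReal)

end UltraParabolic

end

noncomputable section

namespace UltraParabolic

open Filter Topology

/-! Fix `z` in the small box, let `ρ = θ r`, and test the subsolution inequality with `φ Γ₀(z,·)`.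
The kernel solves the adjoint of the equation with `a = 1`, so formally its pole reproduces `w z`
and the derivatives falling on `φ` produce `I₁ z`. What is left is linear in `∂_y w`, with
coefficients `(1 - a) φ ∂_ηΓ₀` and `-a ∂_ηφ Γ₀`. Since `|a| ≤ Λ` and `|∂_ηφ| ≤ 4θ/r`, the excess `w
- I₁` is at most a potential of `|∂_y w|` on `B_{r/θ}^-`, with kernel `(1 + Λ)|∂_ηΓ₀| + (4Λθ/r) Γ₀`
and elapsed times up to `r²` (`ae_ofReal_sub_I₁_le`). As `I₁ ≤ I₀`, only the potential has to be
estimated.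

In the parabolic variables of `move`, both kernels become a power of the elapsed time times a fixed
Gaussian profile, and for each parameter the point moves by a volume preserving map. Minkowski's
inequality then bounds the operator norms on `L²` by the masses of the weights. The part of
`|∂_ηΓ₀|` with elapsed time below `ρ²` has mass of order `ρ`. The later part is bounded pointwise by
Cauchy–Schwarz and gains from the volume of `B_ρ^-`, of order `ρ⁶`. The kernel `Γ₀` has mass `r²`,
which the prefactor turns into `4Λρ`. Each piece contributes `ρ² = θ²r²` after squaring
(`lintegral_potential_sq_le`).

To make the testing legitimate, the pole is removed by a smooth function `ramp ε` of the elapsed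
time. This also keeps the test function away from `t = 0`. The derivative of the ramp creates an
approximate identity, and `w` is recovered almost everywhere from `L¹` continuity and Fatou's lemma.
-/

/-! ### Parabolic changes of variables. -/

lemma lintegral_affine (G : ℝ → ℝ≥0∞) (hG : Measurable G) (b : ℝ) {c : ℝ} (hc : c ≠ 0) :
    ∫⁻ x, G (b - c * x) = ENNReal.ofReal |c⁻¹| * ∫⁻ x, G x := by
  have h1 : ∫⁻ x, G (b - x) = ∫⁻ x, G x := lintegral_sub_left_eq_self G b
  have h2 : ∫⁻ x, G (b - c * x) = ∫⁻ x, G (b - x) ∂(Measure.map (fun x => c * x) volume) := by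
    rw [lintegral_map (by fun_prop) (by fun_prop)]
  rw [h2, Real.map_volume_mul_left hc, lintegral_smul_measure, h1, smul_eq_mul]

lemma lintegral_pt (G : Pt → ℝ≥0∞) (hG : Measurable G) :
    ∫⁻ z, G z = ∫⁻ t, ∫⁻ y, ∫⁻ x, G (x, y, t) := by
  rw [Measure.volume_eq_prod, lintegral_prod_symm _ hG.aemeasurable, Measure.volume_eq_prod,
    lintegral_prod_symm]
  exact (Measurable.lintegral_prod_left' hG).aemeasurable

/-- The point at which the rescaled Kolmogorov kernel with pole at time `z.2.2` is evaluated when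
the Gaussian variables are `p.1, p.2.1` and the elapsed time is `p.2.2`. -/
def move (z p : Pt) : Pt :=
  (z.1 - p.2.2 * z.2.1 + p.2.2 * √p.2.2 * (p.2.1 / 2 - p.1), z.2.1 - √p.2.2 * p.2.1,
    z.2.2 - p.2.2)

lemma continuous_move : Continuous fun q : Pt × Pt => move q.1 q.2 := by
  unfold move; fun_prop

lemma measurable_move : Measurable fun q : Pt × Pt => move q.1 q.2 := continuous_move.measurable

lemma measurable_move_right (z : Pt) : Measurable (move z) :=
  measurable_move.comp (measurable_const.prodMk measurable_id)

lemma measurable_move_left (p : Pt) : Measurable fun z => move z p :=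
  measurable_move.comp (measurable_id.prodMk measurable_const)

/-- For fixed `p` the map is a shear of `x` along `y` followed by a translation, so translation
invariance in each variable suffices. No sign of the elapsed time is needed, since `√` is zero on
negative numbers. -/
lemma lintegral_move_left (G : Pt → ℝ≥0∞) (hG : Measurable G) (p : Pt) :
    ∫⁻ z, G (move z p) = ∫⁻ z, G z := by
  have hGm : Measurable fun z => G (move z p) := hG.comp (measurable_move_left p)
  rw [lintegral_pt _ hGm, lintegral_pt _ hG]
  have hx : ∀ t y, ∫⁻ x, G (move (x, y, t) p)
      = ∫⁻ x, G (x, y - √p.2.2 * p.2.1, t - p.2.2) := by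
    intro t y
    have := lintegral_add_right_eq_self (μ := (volume : Measure ℝ))
      (fun x => G (x, y - √p.2.2 * p.2.1, t - p.2.2))
      (- p.2.2 * y + p.2.2 * √p.2.2 * (p.2.1 / 2 - p.1))
    rw [← this]
    refine lintegral_congr fun x => ?_
    simp only [move]
    congr 2
    ring
  simp only [hx]
  have hy : ∀ t, ∫⁻ y, ∫⁻ x, G (x, y - √p.2.2 * p.2.1, t - p.2.2)
      = ∫⁻ y, ∫⁻ x, G (x, y, t - p.2.2) := fun t =>
    lintegral_sub_right_eq_self (μ := (volume : Measure ℝ))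
      (fun y => ∫⁻ x, G (x, y, t - p.2.2)) _
  simp only [hy]
  exact lintegral_sub_right_eq_self (μ := (volume : Measure ℝ))
      (fun t => ∫⁻ y, ∫⁻ x, G (x, y, t)) _

lemma measurePreserving_move (p : Pt) : MeasurePreserving (fun z => move z p) volume volume := by
  refine ⟨measurable_move_left p, ?_⟩
  ext s hs
  rw [Measure.map_apply (measurable_move_left p) hs, ← lintegral_indicator_one hs,
    ← lintegral_move_left _ (measurable_one.indicator hs) p,
    ← lintegral_indicator_one (measurable_move_left p hs)]
  rfl

/-- The set of parameters with positive elapsed time. -/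
def posTime : Set Pt := {p | 0 < p.2.2}

lemma measurableSet_posTime : MeasurableSet posTime :=
  measurableSet_lt measurable_const measurable_snd.snd

/-- Change of variables `ζ = move z p` on `{τ < t}`. -/
lemma lintegral_move_right (G : Pt → ℝ≥0∞) (hG : Measurable G) (z : Pt) :
    ∫⁻ ζ in {ζ : Pt | ζ.2.2 < z.2.2}, G ζ
      = ∫⁻ p in posTime, ENNReal.ofReal (p.2.2 ^ 2) * G (move z p) := by
  have hS : MeasurableSet {ζ : Pt | ζ.2.2 < z.2.2} :=
    measurableSet_lt measurable_snd.snd measurable_const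
  rw [← lintegral_indicator hS, ← lintegral_indicator measurableSet_posTime,
    lintegral_pt _ (hG.indicator hS), lintegral_pt]
  swap
  · exact Measurable.indicator ((by fun_prop : Measurable fun p : Pt =>
      ENNReal.ofReal (p.2.2 ^ 2)).mul (hG.comp (measurable_move_right z))) measurableSet_posTime
  rw [← lintegral_sub_left_eq_self (μ := (volume : Measure ℝ)) _ z.2.2]
  refine lintegral_congr fun s => ?_
  by_cases hs : 0 < s
  swap
  · have h1 : ∀ x y, ({ζ : Pt | ζ.2.2 < z.2.2}.indicator G (x, y, z.2.2 - s)) = 0 := by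
      intro x y
      refine Set.indicator_of_notMem ?_ _
      simp only [Set.mem_ofPred_eq]; linarith
    have h2 : ∀ x y, (posTime.indicator
        (fun p => ENNReal.ofReal (p.2.2 ^ 2) * G (move z p)) (x, y, s)) = 0 := by
      intro x y
      refine Set.indicator_of_notMem ?_ _
      simpa only [posTime, Set.mem_ofPred_eq] using hs
    simp [h1, h2]
  have h1 : ∀ x y, ({ζ : Pt | ζ.2.2 < z.2.2}.indicator G (x, y, z.2.2 - s))
      = G (x, y, z.2.2 - s) := by
    intro x y
    refine Set.indicator_of_mem ?_ _
    simp only [Set.mem_ofPred_eq]; linarith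
  have h2 : ∀ x y, (posTime.indicator
      (fun p => ENNReal.ofReal (p.2.2 ^ 2) * G (move z p)) (x, y, s))
      = ENNReal.ofReal (s ^ 2) * G (move z (x, y, s)) := by
    intro x y
    exact Set.indicator_of_mem (by simpa only [posTime, Set.mem_ofPred_eq] using hs) _
  simp only [h1, h2]
  have hr : 0 < √s := Real.sqrt_pos.2 hs
  have hm : ∀ y, Measurable fun x => G (x, y, z.2.2 - s) := fun y => hG.comp (by fun_prop)
  have hu : ∀ v, ∫⁻ u, ENNReal.ofReal (s ^ 2) * G (move z (u, v, s))
      = ENNReal.ofReal (s ^ 2) * (ENNReal.ofReal |(s * √s)⁻¹| *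
        ∫⁻ x, G (x, z.2.1 - √s * v, z.2.2 - s)) := by
    intro v
    have hGm : Measurable fun u : ℝ => G (move z (u, v, s)) :=
      hG.comp ((measurable_move_right z).comp
        (by fun_prop : Measurable fun u : ℝ => ((u, v, s) : Pt)))
    rw [lintegral_const_mul _ hGm,
      ← lintegral_affine _ (hm _) (z.1 - s * z.2.1 + s * √s * (v / 2)) (c := s * √s) (by positivity)]
    congr 1
    refine lintegral_congr fun u => ?_
    simp only [move]
    congr 2
    ring
  simp only [hu]
  have hm2 : Measurable fun y => ∫⁻ x, G (x, y, z.2.2 - s) := by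
    refine Measurable.lintegral_prod_right' (f := fun q : ℝ × ℝ => G (q.2, q.1, z.2.2 - s)) ?_
    exact hG.comp (by fun_prop)
  have hm3 : Measurable fun v => ∫⁻ x, G (x, z.2.1 - √s * v, z.2.2 - s) :=
    hm2.comp (by fun_prop : Measurable fun v => z.2.1 - √s * v)
  rw [lintegral_const_mul _ (hm3.const_mul _), lintegral_const_mul _ hm3,
    lintegral_affine _ hm2 z.2.1 hr.ne', ← mul_assoc, ← mul_assoc, ← ENNReal.ofReal_mul (by positivity),
    ← ENNReal.ofReal_mul (by positivity), abs_of_pos (by positivity), abs_of_pos (by positivity)]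
  -- The Jacobian: `u` scales `x` by `s √s` and `v` scales `y` by `√s`, in total `s²`.
  have : s ^ 2 * (s * √s)⁻¹ * (√s)⁻¹ = 1 := by
    have h := Real.mul_self_sqrt hs.le
    field_simp
    nlinarith
  rw [this, ENNReal.ofReal_one, one_mul]

/-! ### Cauchy–Schwarz and Minkowski inequalities. -/

lemma sq_lintegral_mul_le {α : Type*} [MeasurableSpace α] (μ : Measure α) {f g : α → ℝ≥0∞}
    (hf : AEMeasurable f μ) (hg : AEMeasurable g μ) :
    (∫⁻ a, f a * g a ∂μ) ^ 2 ≤ (∫⁻ a, f a ^ 2 ∂μ) * ∫⁻ a, g a ^ 2 ∂μ := by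
  have h := ENNReal.lintegral_mul_le_Lp_mul_Lq μ (Real.HolderConjugate.two_two) hf hg
  have h2 := pow_le_pow_left₀ (zero_le) h 2
  simp only [ENNReal.rpow_ofNat, Pi.mul_apply] at h2
  refine h2.trans_eq ?_
  rw [mul_pow, ← ENNReal.rpow_natCast, ← ENNReal.rpow_mul, ← ENNReal.rpow_natCast,
    ← ENNReal.rpow_mul]
  norm_num

/-- Cauchy–Schwarz for the pair `1`, `F` in the measure with density `k`. -/
lemma sq_lintegral_weight_le {α : Type*} [MeasurableSpace α] (μ : Measure α) {k F : α → ℝ≥0∞}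
    (hk : Measurable k) (hF : Measurable F) :
    (∫⁻ a, k a * F a ∂μ) ^ 2 ≤ (∫⁻ a, k a ∂μ) * ∫⁻ a, k a * F a ^ 2 ∂μ := by
  have h := sq_lintegral_mul_le (μ.withDensity k) (f := fun _ => 1) (g := F)
    aemeasurable_const hF.aemeasurable
  simp only [one_mul, one_pow] at h
  rw [lintegral_withDensity_eq_lintegral_mul _ hk hF,
    lintegral_withDensity_eq_lintegral_mul _ hk (hF.pow_const 2),
    lintegral_withDensity_eq_lintegral_mul _ hk measurable_const] at h
  simpa only [Pi.mul_apply, mul_one] using h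

/-- Minkowski's inequality for averages along the measure preserving maps `move · p`. -/
lemma lintegral_sq_average_move_le {k F : Pt → ℝ≥0∞} (hk : Measurable k) (hF : Measurable F) :
    ∫⁻ z, (∫⁻ p, k p * F (move z p)) ^ 2 ≤ (∫⁻ p, k p) ^ 2 * ∫⁻ z, F z ^ 2 := by
  have hm : Measurable fun q : Pt × Pt => k q.2 * F (move q.1 q.2) ^ 2 :=
    (hk.comp measurable_snd).mul ((hF.comp measurable_move).pow_const 2)
  calc ∫⁻ z, (∫⁻ p, k p * F (move z p)) ^ 2
      ≤ ∫⁻ z, (∫⁻ p, k p) * ∫⁻ p, k p * F (move z p) ^ 2 :=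
        lintegral_mono fun z => sq_lintegral_weight_le _ hk (hF.comp (measurable_move_right z))
    _ = (∫⁻ p, k p) * ∫⁻ z, ∫⁻ p, k p * F (move z p) ^ 2 :=
        lintegral_const_mul _ hm.lintegral_prod_right'
    _ = (∫⁻ p, k p) * ∫⁻ p, ∫⁻ z, k p * F (move z p) ^ 2 := by
        rw [lintegral_lintegral_swap hm.aemeasurable]
    -- Volume preservation makes the inner integral independent of `p`, so the mass of `k` appears a
    -- second time.
    _ = (∫⁻ p, k p) * ∫⁻ p, k p * ∫⁻ z, F z ^ 2 := by
        congr 1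
        refine lintegral_congr fun p => ?_
        have hFm : Measurable fun z => F (move z p) ^ 2 :=
          (hF.comp (measurable_move_left p)).pow_const 2
        rw [lintegral_const_mul _ hFm,
          lintegral_move_left (fun z => F z ^ 2) (hF.pow_const 2)]
    _ = _ := by rw [lintegral_mul_const _ hk, sq, mul_assoc]

/-! ### Gaussian profile and its moments. -/

/-- The profile of the Kolmogorov kernel in the rescaled variables. -/
def gaussW (p : Pt) : ℝ := √3 / (2 * Real.pi) * Real.exp (- p.2.1 ^ 2 / 4 - 3 * p.1 ^ 2)

/-- The logarithmic `η`-derivative of the kernel at unit time in the rescaled variables. -/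
def slope (p : Pt) : ℝ := p.2.1 / 2 + 3 * p.1

lemma gaussW_nonneg (p : Pt) : 0 ≤ gaussW p := by unfold gaussW; positivity

lemma continuous_gaussW : Continuous gaussW := by unfold gaussW; fun_prop

lemma continuous_slope : Continuous slope := by unfold slope; fun_prop

lemma gaussW_le (p : Pt) : gaussW p ≤ Real.exp (- p.2.1 ^ 2 / 4 - 3 * p.1 ^ 2) := by
  have h1 : √3 / (2 * Real.pi) ≤ 1 := by
    rw [div_le_one (by positivity)]
    have : √3 ≤ 2 := Real.sqrt_le_iff.2 ⟨by norm_num, by norm_num⟩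
    have := Real.pi_gt_three
    linarith
  unfold gaussW
  exact mul_le_of_le_one_left (Real.exp_pos _).le h1

/-- The polynomial is absorbed by `1 + q ≤ exp q` with `q = v²/8 + 2u²`, which spends only part of
the Gaussian decay. This single bound serves both `slopeMean` and `slopeEnergy`. -/
lemma slope_sq_le (p : Pt) : (1 + slope p ^ 2) * gaussW p ≤
    9 * Real.exp (-(1 / 8) * p.2.1 ^ 2) * Real.exp (-1 * p.1 ^ 2) := by
  have hs : slope p ^ 2 ≤ 9 * (p.2.1 ^ 2 / 8 + 2 * p.1 ^ 2) := by
    unfold slope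
    nlinarith [sq_nonneg (p.2.1 - 6 * p.1), sq_nonneg p.2.1, sq_nonneg p.1]
  have he := Real.add_one_le_exp (p.2.1 ^ 2 / 8 + 2 * p.1 ^ 2)
  calc (1 + slope p ^ 2) * gaussW p
      ≤ (9 * Real.exp (p.2.1 ^ 2 / 8 + 2 * p.1 ^ 2)) *
        Real.exp (- p.2.1 ^ 2 / 4 - 3 * p.1 ^ 2) :=
        mul_le_mul (by nlinarith) (gaussW_le p) (gaussW_nonneg p) (by positivity)
    _ = _ := by
        rw [mul_assoc, mul_assoc, ← Real.exp_add, ← Real.exp_add]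
        congr 2; ring

lemma lintegral_gauss_lt_top {b : ℝ} (hb : 0 < b) :
    ∫⁻ x : ℝ, ENNReal.ofReal (Real.exp (-b * x ^ 2)) < ⊤ :=
  (integrable_exp_neg_mul_sq hb).lintegral_lt_top

lemma lintegral_lintegral_lt_top {f : ℝ → ℝ → ℝ}
    (hf : ∀ u v, f u v ≤ 9 * Real.exp (-(1 / 8) * v ^ 2) * Real.exp (-1 * u ^ 2)) :
    ∫⁻ v, ∫⁻ u, ENNReal.ofReal (f u v) < ⊤ := by
  have h1 : ∀ v, ∫⁻ u, ENNReal.ofReal (f u v) ≤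
      ENNReal.ofReal (Real.exp (-(1 / 8) * v ^ 2)) *
        (ENNReal.ofReal 9 * ∫⁻ u : ℝ, ENNReal.ofReal (Real.exp (-1 * u ^ 2))) := by
    intro v
    rw [← lintegral_const_mul' _ _ ENNReal.ofReal_ne_top,
      ← lintegral_const_mul' _ _ ENNReal.ofReal_ne_top]
    refine lintegral_mono fun u => ?_
    simp only
    rw [← ENNReal.ofReal_mul (by positivity), ← ENNReal.ofReal_mul (by positivity)]
    refine ENNReal.ofReal_le_ofReal ((hf u v).trans_eq (by ring))
  refine (lintegral_mono h1).trans_lt ?_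
  rw [lintegral_mul_const _ (by fun_prop)]
  exact ENNReal.mul_lt_top (lintegral_gauss_lt_top (b := 1 / 8) (by norm_num))
    (ENNReal.mul_lt_top ENNReal.ofReal_lt_top (lintegral_gauss_lt_top (b := 1) (by norm_num)))

/-- First absolute moment of the slope under the Gaussian profile. -/
def slopeMean : ℝ≥0∞ := ∫⁻ v : ℝ, ∫⁻ u : ℝ, ENNReal.ofReal (|slope (u, v, 0)| * gaussW (u, v, 0))

/-- Squared `L²` norm of the derivative of the Gaussian profile. -/
def slopeEnergy : ℝ≥0∞ :=
  ∫⁻ v : ℝ, ∫⁻ u : ℝ, ENNReal.ofReal ((slope (u, v, 0) * gaussW (u, v, 0)) ^ 2)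

lemma slopeMean_lt_top : slopeMean < ⊤ := by
  refine lintegral_lintegral_lt_top fun u v => le_trans ?_ (slope_sq_le (u, v, 0))
  refine mul_le_mul_of_nonneg_right ?_ (gaussW_nonneg _)
  nlinarith [sq_nonneg (|slope (u, v, 0)| - 1), sq_abs (slope (u, v, 0)),
    abs_nonneg (slope (u, v, 0))]

lemma slopeEnergy_lt_top : slopeEnergy < ⊤ := by
  refine lintegral_lintegral_lt_top fun u v => le_trans ?_ (slope_sq_le (u, v, 0))
  have h0 := gaussW_nonneg (u, v, 0)
  have h1 : gaussW (u, v, 0) ≤ 1 :=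
    (gaussW_le _).trans (Real.exp_le_one_iff.2 (by nlinarith [sq_nonneg u, sq_nonneg v]))
  have h2 : gaussW (u, v, 0) ^ 2 ≤ gaussW (u, v, 0) := by nlinarith
  rw [mul_pow]
  refine mul_le_mul (by linarith) h2 (by positivity) (by positivity)

/-- The Gaussian integrals in `v` and `u` are `2√π` and `√(π/3)`, and the prefactor `√3/(2π)`
cancels them. This normalization makes the kernel an approximate identity. -/
lemma lintegral_gaussW : ∫⁻ v : ℝ, ∫⁻ u : ℝ, ENNReal.ofReal (gaussW (u, v, 0)) = 1 := by
  have hg : ∀ {b : ℝ}, 0 < b → ∫⁻ x : ℝ, ENNReal.ofReal (Real.exp (-b * x ^ 2))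
      = ENNReal.ofReal √(Real.pi / b) := by
    intro b hb
    rw [← integral_gaussian, ofReal_integral_eq_lintegral_ofReal (integrable_exp_neg_mul_sq hb)]
    exact Eventually.of_forall fun x => (Real.exp_pos _).le
  have h1 : ∀ u v : ℝ, ENNReal.ofReal (gaussW (u, v, 0)) = ENNReal.ofReal (√3 / (2 * Real.pi)) *
      ENNReal.ofReal (Real.exp (-(1 / 4) * v ^ 2)) * ENNReal.ofReal (Real.exp (-3 * u ^ 2)) := by
    intro u v
    rw [← ENNReal.ofReal_mul (by positivity), ← ENNReal.ofReal_mul (by positivity), mul_assoc,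
      ← Real.exp_add, gaussW]
    congr 3
    ring
  simp only [h1]
  have h2 : ∀ v : ℝ, ∫⁻ u : ℝ, ENNReal.ofReal (√3 / (2 * Real.pi)) *
      ENNReal.ofReal (Real.exp (-(1 / 4) * v ^ 2)) * ENNReal.ofReal (Real.exp (-3 * u ^ 2))
      = ENNReal.ofReal (√3 / (2 * Real.pi)) * ENNReal.ofReal (Real.exp (-(1 / 4) * v ^ 2)) *
        ENNReal.ofReal √(Real.pi / 3) := by
    intro v
    rw [lintegral_const_mul _ (by fun_prop), hg (by norm_num)]
  simp only [h2]
  rw [lintegral_mul_const _ (by fun_prop), lintegral_const_mul _ (by fun_prop), hg (by norm_num),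
    ← ENNReal.ofReal_mul (by positivity), ← ENNReal.ofReal_mul (by positivity),
    ← ENNReal.ofReal_one]
  congr 1
  have h3 : √(Real.pi / (1 / 4)) = 2 * √Real.pi := by
    rw [show Real.pi / (1 / 4) = 2 ^ 2 * Real.pi by ring, Real.sqrt_mul (by norm_num),
      Real.sqrt_sq (by norm_num)]
  have h4 : √(Real.pi / 3) = √Real.pi / √3 := Real.sqrt_div Real.pi_pos.le 3
  rw [h3, h4]
  have h5 : 0 < √3 := by positivity
  have h6 : 0 < √Real.pi := Real.sqrt_pos.2 Real.pi_pos
  have h7 := Real.mul_self_sqrt Real.pi_pos.le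
  have h8 := Real.pi_pos
  field_simp
  nlinarith

/-- Integrals over the parameters of a product of a function of time and a profile. -/
lemma lintegral_time_profile {A : ℝ → ℝ≥0∞} (hA : Measurable A) {W : Pt → ℝ≥0∞}
    (hW : Measurable W) (hW0 : ∀ u v s, W (u, v, s) = W (u, v, 0)) :
    ∫⁻ p : Pt, A p.2.2 * W p = (∫⁻ s, A s) * ∫⁻ v, ∫⁻ u, W (u, v, 0) := by
  rw [lintegral_pt _ (by fun_prop)]
  have h1 : ∀ s, ∫⁻ v, ∫⁻ u, A s * W (u, v, s) = A s * ∫⁻ v, ∫⁻ u, W (u, v, 0) := by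
    intro s
    have hm : Measurable fun q : ℝ × ℝ => W (q.2, q.1, 0) := hW.comp (by fun_prop)
    simp only [hW0 _ _ s]
    rw [← lintegral_const_mul _ hm.lintegral_prod_right']
    refine lintegral_congr fun v => ?_
    rw [lintegral_const_mul]
    exact hm.comp (measurable_const.prodMk measurable_id)
  simp only [h1]
  rw [lintegral_mul_const _ hA]

/-! ### The kernel in parabolic variables. -/

/-- The `η`-derivative of the Kolmogorov kernel. -/
def kolDY (z ζ : Pt) : ℝ :=
  Γ₀ z ζ * ((z.2.1 - ζ.2.1) / (2 * (z.2.2 - ζ.2.2)) + 3 / (z.2.2 - ζ.2.2) ^ 2 *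
    (z.1 - ζ.1 - (z.2.2 - ζ.2.2) / 2 * (z.2.1 + ζ.2.1)))

lemma Γ₀_nonneg (z ζ : Pt) : 0 ≤ Γ₀ z ζ := by
  unfold Γ₀; split_ifs <;> positivity

lemma measurable_Γ₀ : Measurable fun q : Pt × Pt => Γ₀ q.1 q.2 := by
  unfold Γ₀
  refine Measurable.ite (measurableSet_lt (by fun_prop) (by fun_prop)) (by fun_prop) (by fun_prop)

lemma measurable_kolDY : Measurable fun q : Pt × Pt => kolDY q.1 q.2 := by
  unfold kolDY
  exact measurable_Γ₀.mul (by fun_prop)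

lemma measurable_Γ₀_right (z : Pt) : Measurable (Γ₀ z) :=
  measurable_Γ₀.comp (measurable_const.prodMk measurable_id)

lemma measurable_kolDY_right (z : Pt) : Measurable (kolDY z) :=
  measurable_kolDY.comp (measurable_const.prodMk measurable_id)

lemma Γ₀_of_lt {z ζ : Pt} (h : ζ.2.2 < z.2.2) : Γ₀ z ζ =
    Real.sqrt 3 / (2 * Real.pi * (z.2.2 - ζ.2.2) ^ 2) *
      Real.exp (- (z.2.1 - ζ.2.1) ^ 2 / (4 * (z.2.2 - ζ.2.2))
        - 3 / (z.2.2 - ζ.2.2) ^ 3 *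
          (z.1 - ζ.1 - (z.2.2 - ζ.2.2) / 2 * (z.2.1 + ζ.2.1)) ^ 2) := by
  rw [Γ₀, if_pos h]

lemma Γ₀_of_le {z ζ : Pt} (h : z.2.2 ≤ ζ.2.2) : Γ₀ z ζ = 0 := by
  rw [Γ₀, if_neg h.not_gt]

lemma kolDY_of_le {z ζ : Pt} (h : z.2.2 ≤ ζ.2.2) : kolDY z ζ = 0 := by
  rw [kolDY, Γ₀_of_le h, zero_mul]

lemma dY_Γ₀ (z ζ : Pt) : dY (Γ₀ z) ζ = kolDY z ζ := by
  rcases lt_or_ge ζ.2.2 z.2.2 with h | h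
  · have hs : 0 < z.2.2 - ζ.2.2 := sub_pos.2 h
    have hE : HasDerivAt (fun s : ℝ => - (z.2.1 - s) ^ 2 / (4 * (z.2.2 - ζ.2.2))
        - 3 / (z.2.2 - ζ.2.2) ^ 3 *
          (z.1 - ζ.1 - (z.2.2 - ζ.2.2) / 2 * (z.2.1 + s)) ^ 2)
        ((z.2.1 - ζ.2.1) / (2 * (z.2.2 - ζ.2.2)) + 3 / (z.2.2 - ζ.2.2) ^ 2 *
          (z.1 - ζ.1 - (z.2.2 - ζ.2.2) / 2 * (z.2.1 + ζ.2.1))) ζ.2.1 := by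
      have h1 := ((((hasDerivAt_id ζ.2.1).const_sub z.2.1).pow 2).neg.div_const
        (4 * (z.2.2 - ζ.2.2)))
      have h2 := (((((hasDerivAt_id ζ.2.1).const_add z.2.1).const_mul
        ((z.2.2 - ζ.2.2) / 2)).const_sub (z.1 - ζ.1)).pow 2).const_mul (3 / (z.2.2 - ζ.2.2) ^ 3)
      refine (h1.sub h2).congr_deriv ?_
      simp only [id]
      field_simp
      ring
    have h3 := (hE.exp).const_mul (Real.sqrt 3 / (2 * Real.pi * (z.2.2 - ζ.2.2) ^ 2))
    rw [dY, kolDY, Γ₀_of_lt h]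
    have h4 : (fun s => Γ₀ z (ζ.1, s, ζ.2.2)) = fun s =>
        Real.sqrt 3 / (2 * Real.pi * (z.2.2 - ζ.2.2) ^ 2) *
        Real.exp (- (z.2.1 - s) ^ 2 / (4 * (z.2.2 - ζ.2.2))
        - 3 / (z.2.2 - ζ.2.2) ^ 3 *
          (z.1 - ζ.1 - (z.2.2 - ζ.2.2) / 2 * (z.2.1 + s)) ^ 2) := by
      funext s; exact Γ₀_of_lt h
    rw [h4, h3.deriv]
    ring
  · rw [kolDY_of_le h, dY]
    have h4 : (fun s => Γ₀ z (ζ.1, s, ζ.2.2)) = fun _ => 0 := by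
      funext s; exact Γ₀_of_le h
    rw [h4, deriv_const]

/-- With `ζ = move z p` one has `y - η = √s v` and `x - ξ - (s/2)(y + η) = s √s u`, so the exponent
loses its dependence on `s`. The remaining `s⁻²` is the inverse of the Jacobian. -/
lemma Γ₀_move (z : Pt) {p : Pt} (hp : p ∈ posTime) :
    Γ₀ z (move z p) = gaussW p / p.2.2 ^ 2 := by
  obtain ⟨u, v, s⟩ := p
  have hs : 0 < s := hp
  have hr : 0 < √s := Real.sqrt_pos.2 hs
  have h2 : √s ^ 2 = s := Real.sq_sqrt hs.le
  rw [Γ₀_of_lt (by simp only [move]; linarith)]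
  simp only [move, gaussW, sub_sub_cancel]
  have h3 : -(√s * v) ^ 2 / (4 * s) - 3 / s ^ 3 * (z.1 - (z.1 - s * z.2.1 + s * √s * (v / 2 - u)) -
      s / 2 * (z.2.1 + (z.2.1 - √s * v))) ^ 2 = -v ^ 2 / 4 - 3 * u ^ 2 := by
    have h4 : z.1 - (z.1 - s * z.2.1 + s * √s * (v / 2 - u)) -
      s / 2 * (z.2.1 + (z.2.1 - √s * v)) = s * √s * u := by ring
    rw [h4, mul_pow, mul_pow, mul_pow, h2]
    field_simp
  rw [h3]
  field_simp

/-- One `η`-derivative costs a factor `s^{-1/2}`, which is still integrable at `s = 0`. -/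
lemma kolDY_move (z : Pt) {p : Pt} (hp : p ∈ posTime) :
    kolDY z (move z p) = slope p * gaussW p / (p.2.2 ^ 2 * √p.2.2) := by
  rw [kolDY, Γ₀_move z hp]
  obtain ⟨u, v, s⟩ := p
  have hs : 0 < s := hp
  have hr : 0 < √s := Real.sqrt_pos.2 hs
  have h2 : √s ^ 2 = s := Real.sq_sqrt hs.le
  simp only [move, slope, sub_sub_cancel]
  have h4 : z.1 - (z.1 - s * z.2.1 + s * √s * (v / 2 - u)) -
      s / 2 * (z.2.1 + (z.2.1 - √s * v)) = s * √s * u := by ring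
  rw [h4]
  field_simp
  rw [h2]

/-! ### Kernel estimates on slabs of elapsed time. -/

/-- The slab `{t - b ≤ τ < t - a}` below `z`. -/
def slab (a b : ℝ) (z : Pt) : Set Pt := {ζ | a < z.2.2 - ζ.2.2 ∧ z.2.2 - ζ.2.2 ≤ b}

lemma measurableSet_slab (a b : ℝ) (z : Pt) : MeasurableSet (slab a b z) :=
  (measurableSet_lt (by fun_prop : Measurable fun _ : Pt => a)
    (by fun_prop : Measurable fun ζ : Pt => z.2.2 - ζ.2.2)).inter
    (measurableSet_le (by fun_prop : Measurable fun ζ : Pt => z.2.2 - ζ.2.2)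
      (by fun_prop : Measurable fun _ : Pt => b))

lemma setLIntegral_slab {a b : ℝ} (ha : 0 ≤ a) (G : Pt → ℝ≥0∞) (hG : Measurable G) (z : Pt) :
    ∫⁻ ζ in slab a b z, G ζ
      = ∫⁻ p, (Set.Ioc a b).indicator (fun s => ENNReal.ofReal (s ^ 2)) p.2.2 * G (move z p) := by
  have h1 : slab a b z ⊆ {ζ : Pt | ζ.2.2 < z.2.2} := fun ζ hζ => sub_pos.1 (ha.trans_lt hζ.1)
  rw [← Set.inter_eq_left.2 h1, ← Measure.restrict_restrict (measurableSet_slab a b z),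
    ← lintegral_indicator (measurableSet_slab a b z),
    lintegral_move_right _ (hG.indicator (measurableSet_slab a b z)),
    ← lintegral_indicator measurableSet_posTime]
  refine lintegral_congr fun p => ?_
  have h2 : z.2.2 - (move z p).2.2 = p.2.2 := by simp [move]
  by_cases hp : p.2.2 ∈ Set.Ioc a b
  · have h3 : move z p ∈ slab a b z := ⟨by rw [h2]; exact hp.1, by rw [h2]; exact hp.2⟩
    have h4 : p ∈ posTime := ha.trans_lt hp.1
    rw [Set.indicator_of_mem h4, Set.indicator_of_mem h3, Set.indicator_of_mem hp]
  · rw [Set.indicator_of_notMem hp, zero_mul]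
    by_cases h4 : p ∈ posTime
    · have h3 : move z p ∉ slab a b z :=
        fun h => hp ⟨by rw [← h2]; exact h.1, by rw [← h2]; exact h.2⟩
      rw [Set.indicator_of_mem h4, Set.indicator_of_notMem h3, mul_zero]
    · rw [Set.indicator_of_notMem h4]

lemma lintegral_inv_sqrt {b : ℝ} (hb : 0 ≤ b) :
    ∫⁻ s in Set.Ioc 0 b, ENNReal.ofReal (√s)⁻¹ = ENNReal.ofReal (2 * √b) := by
  have h0 : ∀ s : ℝ, (√s)⁻¹ = s ^ (-(1 / 2) : ℝ) ∨ s < 0 := by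
    intro s
    rcases le_or_gt 0 s with h | h
    · left; rw [Real.rpow_neg h, Real.sqrt_eq_rpow]
    · right; exact h
  have h1 : ∫⁻ s in Set.Ioc 0 b, ENNReal.ofReal (√s)⁻¹
      = ∫⁻ s in Set.Ioc 0 b, ENNReal.ofReal (s ^ (-(1 / 2) : ℝ)) := by
    refine setLIntegral_congr_fun measurableSet_Ioc fun s hs => ?_
    rcases h0 s with h | h
    · simp only [h]
    · exact absurd hs.1 h.not_gt
  have h2 : IntervalIntegrable (fun s : ℝ => s ^ (-(1 / 2) : ℝ)) volume 0 b :=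
    intervalIntegral.intervalIntegrable_rpow' (by norm_num)
  rw [h1, ← ofReal_integral_eq_lintegral_ofReal
    ((intervalIntegrable_iff_integrableOn_Ioc_of_le hb).1 h2),
    ← intervalIntegral.integral_of_le hb, integral_rpow (Or.inl (by norm_num))]
  · congr 1
    rw [Real.sqrt_eq_rpow, Real.zero_rpow (by norm_num)]
    norm_num
    ring
  · filter_upwards [ae_restrict_mem measurableSet_Ioc] with s hs
    exact Real.rpow_nonneg hs.1.le _

lemma lintegral_inv_cube_le {a : ℝ} (ha : 0 < a) (b : ℝ) :
    ∫⁻ s in Set.Ioc a b, ENNReal.ofReal (s ^ 3)⁻¹ ≤ ENNReal.ofReal (2 * a ^ 2)⁻¹ := by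
  have h1 : ∫⁻ s in Set.Ioc a b, ENNReal.ofReal (s ^ 3)⁻¹
      ≤ ∫⁻ s in Set.Ioi a, ENNReal.ofReal (s ^ (-3 : ℝ)) := by
    refine (lintegral_mono_set Set.Ioc_subset_Ioi_self).trans_eq ?_
    refine setLIntegral_congr_fun measurableSet_Ioi fun s hs => ?_
    rw [Real.rpow_neg (ha.trans hs).le]
    norm_cast
  refine h1.trans_eq ?_
  rw [← ofReal_integral_eq_lintegral_ofReal (integrableOn_Ioi_rpow_of_lt (by norm_num) ha),
    integral_Ioi_rpow_of_lt (by norm_num) ha]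
  · congr 1
    rw [show (-3 + 1 : ℝ) = -2 by norm_num, Real.rpow_neg ha.le, Real.rpow_two]
    field_simp
  · filter_upwards [ae_restrict_mem measurableSet_Ioi] with s hs
    exact Real.rpow_nonneg (ha.trans hs).le _

/-- The kernel `|∂_η Γ₀|` in the rescaled variables. -/
def nearWeight (b : ℝ) (p : Pt) : ℝ≥0∞ :=
  (Set.Ioc 0 b).indicator (fun s => ENNReal.ofReal (√s)⁻¹) p.2.2 *
    ENNReal.ofReal (|slope p| * gaussW p)

/-- The kernel `Γ₀` in the rescaled variables. -/
def kernelWeight (b : ℝ) (p : Pt) : ℝ≥0∞ :=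
  (Set.Ioc 0 b).indicator (fun _ => 1) p.2.2 * ENNReal.ofReal (gaussW p)

lemma measurable_nearWeight (b : ℝ) : Measurable (nearWeight b) := by
  have h1 : Measurable ((Set.Ioc 0 b).indicator (fun s => ENNReal.ofReal (√s)⁻¹)) :=
    Measurable.indicator (by fun_prop) measurableSet_Ioc
  have h2 := continuous_slope.measurable
  have h3 := continuous_gaussW.measurable
  have h4 : Measurable fun p => |slope p| := by simpa only [Real.norm_eq_abs] using h2.norm
  exact (h1.comp measurable_snd.snd).mul (h4.mul h3).ennreal_ofReal

lemma measurable_kernelWeight (b : ℝ) : Measurable (kernelWeight b) := by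
  have h1 : Measurable ((Set.Ioc 0 b).indicator (fun _ => (1 : ℝ≥0∞))) :=
    Measurable.indicator measurable_const measurableSet_Ioc
  exact (h1.comp measurable_snd.snd).mul continuous_gaussW.measurable.ennreal_ofReal

lemma lintegral_nearWeight {b : ℝ} (hb : 0 ≤ b) :
    ∫⁻ p, nearWeight b p = ENNReal.ofReal (2 * √b) * slopeMean := by
  have h4 : Measurable fun p => |slope p| := by
    simpa only [Real.norm_eq_abs] using continuous_slope.measurable.norm
  have h5 : Measurable fun p => ENNReal.ofReal (|slope p| * gaussW p) :=
    (h4.mul continuous_gaussW.measurable).ennreal_ofReal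
  unfold nearWeight
  rw [lintegral_time_profile (Measurable.indicator (by fun_prop) measurableSet_Ioc)
    h5 (fun u v s => rfl),
    lintegral_indicator measurableSet_Ioc, lintegral_inv_sqrt hb]
  rfl

lemma lintegral_kernelWeight (b : ℝ) : ∫⁻ p, kernelWeight b p = ENNReal.ofReal b := by
  unfold kernelWeight
  rw [lintegral_time_profile (Measurable.indicator measurable_const measurableSet_Ioc)
    continuous_gaussW.measurable.ennreal_ofReal (fun u v s => rfl),
    lintegral_indicator measurableSet_Ioc, lintegral_gaussW]
  simp

lemma setLIntegral_slab_kolDY (b : ℝ) {F : Pt → ℝ≥0∞} (hF : Measurable F) (z : Pt) :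
    ∫⁻ ζ in slab 0 b z, ‖kolDY z ζ‖ₑ * F ζ = ∫⁻ p, nearWeight b p * F (move z p) := by
  have hm : Measurable fun ζ => ‖kolDY z ζ‖ₑ * F ζ := (measurable_kolDY_right z).enorm.mul hF
  rw [setLIntegral_slab le_rfl _ hm]
  refine lintegral_congr fun p => ?_
  rw [nearWeight, ← mul_assoc]
  congr 1
  by_cases hp : p.2.2 ∈ Set.Ioc 0 b
  · have hs : 0 < p.2.2 := hp.1
    have hr : 0 < √p.2.2 := Real.sqrt_pos.2 hs
    rw [Set.indicator_of_mem hp, Set.indicator_of_mem hp, kolDY_move z hs, Real.enorm_eq_ofReal_abs,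
      ← ENNReal.ofReal_mul (by positivity), ← ENNReal.ofReal_mul (by positivity), abs_div, abs_mul,
      abs_of_nonneg (gaussW_nonneg p), abs_of_pos (by positivity : 0 < p.2.2 ^ 2 * √p.2.2)]
    congr 1
    field_simp
  · rw [Set.indicator_of_notMem hp, Set.indicator_of_notMem hp, zero_mul, zero_mul]

lemma setLIntegral_slab_Γ₀ (b : ℝ) {F : Pt → ℝ≥0∞} (hF : Measurable F) (z : Pt) :
    ∫⁻ ζ in slab 0 b z, ‖Γ₀ z ζ‖ₑ * F ζ = ∫⁻ p, kernelWeight b p * F (move z p) := by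
  have hm : Measurable fun ζ => ‖Γ₀ z ζ‖ₑ * F ζ := (measurable_Γ₀_right z).enorm.mul hF
  rw [setLIntegral_slab le_rfl _ hm]
  refine lintegral_congr fun p => ?_
  rw [kernelWeight, ← mul_assoc]
  congr 1
  by_cases hp : p.2.2 ∈ Set.Ioc 0 b
  · have hs : 0 < p.2.2 := hp.1
    rw [Set.indicator_of_mem hp, Set.indicator_of_mem hp, Γ₀_move z hs, Real.enorm_eq_ofReal_abs,
      ← ENNReal.ofReal_mul (by positivity), one_mul, abs_div,
      abs_of_nonneg (gaussW_nonneg p), abs_of_pos (by positivity : 0 < p.2.2 ^ 2)]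
    congr 1
    field_simp
  · rw [Set.indicator_of_notMem hp, Set.indicator_of_notMem hp, zero_mul, zero_mul]

/-- After the change of variables this is an average of `F` along volume preserving maps, so the
operator norm on `L²` is at most the mass of the weight. -/
lemma lintegral_near_sq_le {b : ℝ} (hb : 0 ≤ b) {F : Pt → ℝ≥0∞} (hF : Measurable F) :
    ∫⁻ z, (∫⁻ ζ in slab 0 b z, ‖kolDY z ζ‖ₑ * F ζ) ^ 2
      ≤ (ENNReal.ofReal (2 * √b) * slopeMean) ^ 2 * ∫⁻ z, F z ^ 2 := by
  simp only [setLIntegral_slab_kolDY b hF]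
  rw [← lintegral_nearWeight hb]
  exact lintegral_sq_average_move_le (measurable_nearWeight b) hF

lemma lintegral_Γ₀_sq_le (b : ℝ) {F : Pt → ℝ≥0∞} (hF : Measurable F) :
    ∫⁻ z, (∫⁻ ζ in slab 0 b z, ‖Γ₀ z ζ‖ₑ * F ζ) ^ 2
      ≤ ENNReal.ofReal b ^ 2 * ∫⁻ z, F z ^ 2 := by
  simp only [setLIntegral_slab_Γ₀ b hF]
  rw [← lintegral_kernelWeight b]
  exact lintegral_sq_average_move_le (measurable_kernelWeight b) hF

/-- The squared kernel has size `s⁻⁵` and the Jacobian is `s²`, leaving the tail of `s⁻³`. It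
diverges at `s = 0`, which is why short elapsed times need the averaging argument instead. -/
lemma lintegral_far_kolDY_sq_le {a : ℝ} (ha : 0 < a) (b : ℝ) (z : Pt) :
    ∫⁻ ζ in slab a b z, ‖kolDY z ζ‖ₑ ^ 2 ≤ ENNReal.ofReal (2 * a ^ 2)⁻¹ * slopeEnergy := by
  rw [setLIntegral_slab ha.le _ ((measurable_kolDY_right z).enorm.pow_const 2)]
  have h1 : ∀ p : Pt, (Set.Ioc a b).indicator (fun s => ENNReal.ofReal (s ^ 2)) p.2.2 *
      ‖kolDY z (move z p)‖ₑ ^ 2 = (Set.Ioc a b).indicator (fun s => ENNReal.ofReal (s ^ 3)⁻¹) p.2.2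
        * ENNReal.ofReal ((slope p * gaussW p) ^ 2) := by
    intro p
    by_cases hp : p.2.2 ∈ Set.Ioc a b
    · have hs : 0 < p.2.2 := ha.trans hp.1
      have hr : 0 < √p.2.2 := Real.sqrt_pos.2 hs
      have h2 : √p.2.2 ^ 2 = p.2.2 := Real.sq_sqrt hs.le
      rw [Set.indicator_of_mem hp, Set.indicator_of_mem hp, kolDY_move z hs,
        Real.enorm_eq_ofReal_abs, ← ENNReal.ofReal_pow (by positivity), sq_abs,
        ← ENNReal.ofReal_mul (by positivity), ← ENNReal.ofReal_mul (by positivity)]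
      congr 1
      rw [div_pow, mul_pow (p.2.2 ^ 2), h2]
      field_simp
    · rw [Set.indicator_of_notMem hp, Set.indicator_of_notMem hp, zero_mul, zero_mul]
  simp only [h1]
  have h2 : Measurable fun p => ENNReal.ofReal ((slope p * gaussW p) ^ 2) :=
    ((continuous_slope.mul continuous_gaussW).pow 2).measurable.ennreal_ofReal
  rw [lintegral_time_profile (Measurable.indicator (by fun_prop) measurableSet_Ioc) h2
    (fun u v s => rfl), lintegral_indicator measurableSet_Ioc]
  exact mul_le_mul_left (lintegral_inv_cube_le ha b) _

lemma far_sq_le {a : ℝ} (ha : 0 < a) (b : ℝ) {F : Pt → ℝ≥0∞} (hF : Measurable F) (z : Pt) :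
    (∫⁻ ζ in slab a b z, ‖kolDY z ζ‖ₑ * F ζ) ^ 2
      ≤ ENNReal.ofReal (2 * a ^ 2)⁻¹ * slopeEnergy * ∫⁻ z, F z ^ 2 := by
  refine (sq_lintegral_mul_le _ (measurable_kolDY_right z).enorm.aemeasurable
    hF.aemeasurable).trans ?_
  exact mul_le_mul' (lintegral_far_kolDY_sq_le ha b z) (lintegral_mono' Measure.restrict_le_self le_rfl)

lemma lintegral_slab_kolDY_lt_top {b : ℝ} (hb : 0 ≤ b) (z : Pt) :
    ∫⁻ ζ in slab 0 b z, ‖kolDY z ζ‖ₑ < ⊤ := by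
  have h := setLIntegral_slab_kolDY b (F := fun _ => 1) measurable_const z
  simp only [mul_one] at h
  rw [h, lintegral_nearWeight hb]
  exact ENNReal.mul_lt_top ENNReal.ofReal_lt_top slopeMean_lt_top

lemma lintegral_slab_Γ₀_lt_top (b : ℝ) (z : Pt) : ∫⁻ ζ in slab 0 b z, ‖Γ₀ z ζ‖ₑ < ⊤ := by
  have h := setLIntegral_slab_Γ₀ b (F := fun _ => 1) measurable_const z
  simp only [mul_one] at h
  rw [h, lintegral_kernelWeight]
  exact ENNReal.ofReal_lt_top

lemma volume_Bminus_le {ρ : ℝ} (hρ : 0 < ρ) :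
    volume (Bminus ρ) ≤ ENNReal.ofReal (4 * ρ ^ 6) := by
  have h1 : Bminus ρ ⊆ Set.Ioo (-ρ ^ 3) (ρ ^ 3) ×ˢ (Set.Ioo (-ρ) ρ ×ˢ Set.Ioo (-ρ ^ 2) 0) := by
    rintro ⟨x, y, t⟩ ⟨hx, hy, ht⟩
    exact ⟨abs_lt.1 hx, abs_lt.1 hy, ht⟩
  refine (measure_mono h1).trans_eq ?_
  rw [Measure.volume_eq_prod, Measure.prod_prod, Measure.volume_eq_prod, Measure.prod_prod,
    Real.volume_Ioo, Real.volume_Ioo, Real.volume_Ioo, ← ENNReal.ofReal_mul (by linarith),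
    ← ENNReal.ofReal_mul (by nlinarith [pow_pos hρ 3])]
  congr 1; ring

/-! ### Square-integral estimate of the potential. -/

/-- The potential controlling `w - I₁`. -/
def potential (A κ r : ℝ) (F : Pt → ℝ≥0∞) (z : Pt) : ℝ≥0∞ :=
  ∫⁻ ζ in slab 0 (r ^ 2) z,
    (ENNReal.ofReal A * ‖kolDY z ζ‖ₑ + ENNReal.ofReal κ * ‖Γ₀ z ζ‖ₑ) * F ζ

/-- Only the derivative kernel is split at elapsed time `ρ²`. Its mass up to time `r²` is of order
`r`, too large, whereas the mass of `Γ₀` is compensated by the small factor `κ`. -/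
lemma potential_le (A κ ρ r : ℝ) {F : Pt → ℝ≥0∞}
    (hF : Measurable F) (z : Pt) :
    potential A κ r F z ≤ ENNReal.ofReal A * (∫⁻ ζ in slab 0 (ρ ^ 2) z, ‖kolDY z ζ‖ₑ * F ζ)
      + ENNReal.ofReal A * (∫⁻ ζ in slab (ρ ^ 2) (r ^ 2) z, ‖kolDY z ζ‖ₑ * F ζ)
      + ENNReal.ofReal κ * ∫⁻ ζ in slab 0 (r ^ 2) z, ‖Γ₀ z ζ‖ₑ * F ζ := by
  have m1 : Measurable fun ζ => ‖kolDY z ζ‖ₑ * F ζ := (measurable_kolDY_right z).enorm.mul hF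
  have m2 : Measurable fun ζ => ‖Γ₀ z ζ‖ₑ * F ζ := (measurable_Γ₀_right z).enorm.mul hF
  unfold potential
  simp only [add_mul, mul_assoc]
  rw [lintegral_add_left (m1.const_mul _), lintegral_const_mul _ m1, lintegral_const_mul _ m2,
    ← mul_add]
  gcongr
  refine (lintegral_mono_set ?_).trans (lintegral_union_le _ _ _)
  rintro ζ ⟨h1, h2⟩
  rcases le_or_gt (z.2.2 - ζ.2.2) (ρ ^ 2) with h | h
  · exact Or.inl ⟨h1, h⟩
  · exact Or.inr ⟨h, h2⟩

lemma sq_add_three_le (a b c : ℝ≥0∞) : (a + b + c) ^ 2 ≤ 3 * (a ^ 2 + b ^ 2 + c ^ 2) := by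
  by_cases h : a = ⊤ ∨ b = ⊤ ∨ c = ⊤
  · rcases h with rfl | rfl | rfl <;> simp [ENNReal.mul_top]
  · push Not at h
    lift a to NNReal using h.1
    lift b to NNReal using h.2.1
    lift c to NNReal using h.2.2
    norm_cast
    rw [← NNReal.coe_le_coe]
    push_cast
    nlinarith [sq_nonneg ((a : ℝ) - b), sq_nonneg ((a : ℝ) - c), sq_nonneg ((b : ℝ) - c)]

/-- `L² → L²(B_ρ)` estimate for the potential, with the gain of one power of `ρ`. -/
lemma lintegral_potential_sq_le {A κ c ρ r : ℝ} (hA : 0 ≤ A) (hc : 0 ≤ c) (hρ : 0 < ρ)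
    (hκ : κ * r ^ 2 = c * ρ) (hκ0 : 0 ≤ κ) {F : Pt → ℝ≥0∞} (hF : Measurable F) :
    ∫⁻ z in Bminus ρ, potential A κ r F z ^ 2 ≤
      ENNReal.ofReal (3 * (A ^ 2 * (4 * slopeMean.toReal ^ 2) + A ^ 2 * (2 * slopeEnergy.toReal)
        + c ^ 2) * ρ ^ 2) * ∫⁻ z, F z ^ 2 := by
  set E := ∫⁻ z, F z ^ 2
  set a1 := fun z => ∫⁻ ζ in slab 0 (ρ ^ 2) z, ‖kolDY z ζ‖ₑ * F ζ
  set a2 := fun z => ∫⁻ ζ in slab (ρ ^ 2) (r ^ 2) z, ‖kolDY z ζ‖ₑ * F ζ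
  set a3 := fun z => ∫⁻ ζ in slab 0 (r ^ 2) z, ‖Γ₀ z ζ‖ₑ * F ζ
  have hm1 : Measurable a1 := by
    simp only [a1, setLIntegral_slab_kolDY _ hF]
    exact Measurable.lintegral_prod_right' (f := fun q : Pt × Pt =>
      nearWeight (ρ ^ 2) q.2 * F (move q.1 q.2))
      (((measurable_nearWeight _).comp measurable_snd).mul (hF.comp measurable_move))
  have hb1 : ∫⁻ z in Bminus ρ, a1 z ^ 2 ≤
      ENNReal.ofReal (4 * slopeMean.toReal ^ 2 * ρ ^ 2) * E := by
    refine (lintegral_mono' Measure.restrict_le_self le_rfl).trans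
      ((lintegral_near_sq_le (by positivity) hF).trans_eq ?_)
    congr 1
    rw [Real.sqrt_sq hρ.le, ← ENNReal.ofReal_toReal slopeMean_lt_top.ne,
      ← ENNReal.ofReal_mul (by positivity), ← ENNReal.ofReal_pow (by positivity),
      ENNReal.toReal_ofReal (by positivity)]
    congr 1; ring
  have hb2 : ∫⁻ z in Bminus ρ, a2 z ^ 2 ≤
      ENNReal.ofReal (2 * slopeEnergy.toReal * ρ ^ 2) * E := by
    refine (lintegral_mono fun z => far_sq_le (by positivity) _ hF z).trans ?_
    rw [lintegral_const, Measure.restrict_apply_univ]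
    -- The pointwise bound carries `1/(2ρ⁴)`; the volume `4ρ⁶` leaves `2ρ²`.
    refine (mul_le_mul_right (volume_Bminus_le hρ) _).trans_eq ?_
    rw [mul_right_comm]
    congr 1
    rw [← ENNReal.ofReal_toReal slopeEnergy_lt_top.ne, ← ENNReal.ofReal_mul (by positivity),
      ← ENNReal.ofReal_mul (by positivity), ENNReal.toReal_ofReal (by positivity)]
    congr 1
    field_simp
    ring
  have hb3 : ∫⁻ z in Bminus ρ, a3 z ^ 2 ≤ ENNReal.ofReal (r ^ 2) ^ 2 * E :=
    (lintegral_mono' Measure.restrict_le_self le_rfl).trans (lintegral_Γ₀_sq_le _ hF)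
  calc ∫⁻ z in Bminus ρ, potential A κ r F z ^ 2
      ≤ ∫⁻ z in Bminus ρ, 3 * ((ENNReal.ofReal A * a1 z) ^ 2 + (ENNReal.ofReal A * a2 z) ^ 2
        + (ENNReal.ofReal κ * a3 z) ^ 2) := by
        refine lintegral_mono fun z => ?_
        exact (pow_le_pow_left₀ zero_le (potential_le A κ ρ r hF z) 2).trans
          (sq_add_three_le _ _ _)
    _ = 3 * (∫⁻ z in Bminus ρ, ((ENNReal.ofReal A * a1 z) ^ 2 + (ENNReal.ofReal A * a2 z) ^ 2
        + (ENNReal.ofReal κ * a3 z) ^ 2)) := lintegral_const_mul' _ _ (by simp)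
    _ = 3 * (ENNReal.ofReal A ^ 2 * (∫⁻ z in Bminus ρ, a1 z ^ 2) +
          ENNReal.ofReal A ^ 2 * (∫⁻ z in Bminus ρ, a2 z ^ 2) +
          ENNReal.ofReal κ ^ 2 * ∫⁻ z in Bminus ρ, a3 z ^ 2) := by
        have hm3 : Measurable a3 := by
          simp only [a3, setLIntegral_slab_Γ₀ _ hF]
          exact Measurable.lintegral_prod_right' (f := fun q : Pt × Pt =>
            kernelWeight (r ^ 2) q.2 * F (move q.1 q.2))
            (((measurable_kernelWeight _).comp measurable_snd).mul (hF.comp measurable_move))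
        simp only [mul_pow]
        rw [lintegral_add_right _ ((hm3.pow_const 2).const_mul _),
          lintegral_add_left ((hm1.pow_const 2).const_mul _)]
        simp only [lintegral_const_mul' _ _ (ENNReal.pow_ne_top (n := 2) ENNReal.ofReal_ne_top)]
    _ ≤ 3 * (ENNReal.ofReal A ^ 2 * (ENNReal.ofReal (4 * slopeMean.toReal ^ 2 * ρ ^ 2) * E) +
          ENNReal.ofReal A ^ 2 * (ENNReal.ofReal (2 * slopeEnergy.toReal * ρ ^ 2) * E) +
          ENNReal.ofReal κ ^ 2 * (ENNReal.ofReal (r ^ 2) ^ 2 * E)) := by gcongr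
    _ = _ := by
        simp only [← mul_assoc]
        rw [← add_mul, ← add_mul, ← mul_assoc]
        congr 1
        -- The relation `κ r² = c ρ` gives the third term the same factor `ρ²` as the other two.
        rw [← mul_pow (ENNReal.ofReal κ), ← ENNReal.ofReal_mul hκ0, hκ, ← ENNReal.ofReal_pow hA,
          ← ENNReal.ofReal_pow (by positivity), ← ENNReal.ofReal_mul (by positivity),
          ← ENNReal.ofReal_mul (by positivity), ← ENNReal.ofReal_add (by positivity) (by positivity),
          ← ENNReal.ofReal_add (by positivity) (by positivity),
          show (3 : ℝ≥0∞) = ENNReal.ofReal 3 by simp, ← ENNReal.ofReal_mul (by norm_num)]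
        congr 1; ring

/-! ### Time ramp and recovery of a function from its kernel averages. -/

/-- A smooth monotone function of the elapsed time rising from `0` at `ε` to `1` at `2ε`. -/
def ramp (ε s : ℝ) : ℝ := Real.smoothTransition (s / ε - 1)

lemma contDiff_ramp (ε : ℝ) : ContDiff ℝ ∞ (ramp ε) := by
  unfold ramp
  exact Real.smoothTransition.contDiff.comp (by fun_prop)

lemma ramp_nonneg (ε s : ℝ) : 0 ≤ ramp ε s := Real.smoothTransition.nonneg _

lemma ramp_le_one (ε s : ℝ) : ramp ε s ≤ 1 := Real.smoothTransition.le_one _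

lemma ramp_of_le {ε s : ℝ} (hε : 0 < ε) (h : s ≤ ε) : ramp ε s = 0 :=
  Real.smoothTransition.zero_of_nonpos (sub_nonpos.2 ((div_le_one hε).2 h))

lemma ramp_of_ge {ε s : ℝ} (hε : 0 < ε) (h : 2 * ε ≤ s) : ramp ε s = 1 :=
  Real.smoothTransition.one_of_one_le (by rw [le_sub_iff_add_le, le_div_iff₀ hε]; linarith)

lemma continuous_deriv_ramp (ε : ℝ) : Continuous (deriv (ramp ε)) :=
  (contDiff_ramp ε).continuous_deriv (by simp)

lemma deriv_ramp_nonneg {ε : ℝ} (hε : 0 < ε) (s : ℝ) : 0 ≤ deriv (ramp ε) s := by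
  have : Monotone (ramp ε) := fun a b hab => Real.smoothTransition.monotone (by gcongr)
  exact this.deriv_nonneg

lemma deriv_ramp_of_notMem {ε s : ℝ} (hε : 0 < ε) (h : s ∉ Set.Icc ε (2 * ε)) :
    deriv (ramp ε) s = 0 := by
  rcases lt_or_ge s ε with h1 | h1
  · have : ramp ε =ᶠ[𝓝 s] fun _ => 0 := by
      filter_upwards [Iio_mem_nhds h1] with x hx using ramp_of_le hε (le_of_lt hx)
    rw [this.deriv_eq, deriv_const]
  · have h2 : 2 * ε < s := not_le.1 fun h3 => h ⟨h1, h3⟩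
    have : ramp ε =ᶠ[𝓝 s] fun _ => 1 := by
      filter_upwards [Ioi_mem_nhds h2] with x hx using ramp_of_ge hε (le_of_lt hx)
    rw [this.deriv_eq, deriv_const]

lemma lintegral_deriv_ramp {ε : ℝ} (hε : 0 < ε) :
    ∫⁻ s, ENNReal.ofReal (deriv (ramp ε) s) = 1 := by
  have h1 : ∫⁻ s, ENNReal.ofReal (deriv (ramp ε) s)
      = ∫⁻ s in Set.Ioc ε (2 * ε), ENNReal.ofReal (deriv (ramp ε) s) := by
    rw [restrict_Ioc_eq_restrict_Icc, ← lintegral_indicator measurableSet_Icc]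
    refine lintegral_congr fun s => ?_
    by_cases h : s ∈ Set.Icc ε (2 * ε)
    · rw [Set.indicator_of_mem h]
    · rw [Set.indicator_of_notMem h, deriv_ramp_of_notMem hε h, ENNReal.ofReal_zero]
  have hi : IntervalIntegrable (deriv (ramp ε)) volume ε (2 * ε) :=
    (continuous_deriv_ramp ε).intervalIntegrable _ _
  rw [h1, ← ofReal_integral_eq_lintegral_ofReal
    ((intervalIntegrable_iff_integrableOn_Ioc_of_le (by linarith)).1 hi)
    (Eventually.of_forall (deriv_ramp_nonneg hε)), ← intervalIntegral.integral_of_le (by linarith),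
    intervalIntegral.integral_deriv_eq_sub
      (fun x _ => ((contDiff_ramp ε).differentiable (by simp)) x) hi,
    ramp_of_ge hε le_rfl, ramp_of_le hε le_rfl]
  simp

/-- `L¹` modulus of continuity of `f` along `move · p`. -/
def moveModulus (f : Pt → ℝ) (p : Pt) : ℝ≥0∞ := ∫⁻ z, ‖f (move z p) - f z‖ₑ

lemma measurable_move_sub {f : Pt → ℝ} (hf : Measurable f) :
    Measurable fun q : Pt × Pt => ‖f (move q.1 q.2) - f q.1‖ₑ :=
  ((hf.comp measurable_move).sub (hf.comp measurable_fst)).enorm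

lemma measurable_moveModulus {f : Pt → ℝ} (hf : Measurable f) : Measurable (moveModulus f) :=
  (measurable_move_sub hf).lintegral_prod_left'

lemma moveModulus_le {f : Pt → ℝ} (hf : Measurable f) (p : Pt) :
    moveModulus f p ≤ 2 * ∫⁻ z, ‖f z‖ₑ := by
  calc moveModulus f p ≤ ∫⁻ z, (‖f (move z p)‖ₑ + ‖f z‖ₑ) := lintegral_mono fun z => enorm_sub_le
    _ = 2 * ∫⁻ z, ‖f z‖ₑ := by
      rw [lintegral_add_right _ hf.enorm, lintegral_move_left (fun z => ‖f z‖ₑ) hf.enorm, two_mul]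

/-- At `s = 0` the map is the identity, and `s ↦ move · (u, v, s)` is continuous for the
compact-open topology. Composition with such a family of volume preserving maps is continuous in
`L¹`. -/
lemma tendsto_moveModulus {f : Pt → ℝ} (hf : Integrable f) (u v : ℝ) :
    Tendsto (fun s => moveModulus f (u, v, s)) (𝓝 0) (𝓝 0) := by
  let g : C(ℝ, C(Pt, Pt)) := ContinuousMap.curry
    ⟨fun q : ℝ × Pt => move q.2 (u, v, q.1), continuous_move.comp
      (by fun_prop : Continuous fun q : ℝ × Pt => (q.2, ((u, v, q.1) : Pt)))⟩
  have hm : ∀ s, MeasurePreserving (g s) volume volume := fun s =>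
    measurePreserving_move (u, v, s)
  have hf1 : MemLp f 1 volume := memLp_one_iff_integrable.2 hf
  have h1 : Tendsto (fun s => Lp.compMeasurePreserving (g s) (hm s) (hf1.toLp f)) (𝓝 0)
      (𝓝 (Lp.compMeasurePreserving (g 0) (hm 0) (hf1.toLp f))) :=
    Filter.Tendsto.compMeasurePreservingLp tendsto_const_nhds g.continuous.continuousAt hm (hm 0)
      ENNReal.one_ne_top
  have h2 := tendsto_iff_edist_tendsto_0.1 h1
  refine h2.congr fun s => ?_
  rw [Lp.toLp_compMeasurePreserving, Lp.toLp_compMeasurePreserving, Lp.edist_toLp_toLp,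
    eLpNorm_one_eq_lintegral_enorm]
  refine lintegral_congr fun z => ?_
  simp [g, move]

/-- The modulus of continuity averaged over the Gaussian variables. -/
def gaussModulus (f : Pt → ℝ) (s : ℝ) : ℝ≥0∞ :=
  ∫⁻ v, ∫⁻ u, ENNReal.ofReal (gaussW (u, v, 0)) * moveModulus f (u, v, s)

lemma measurable_gauss_mul_modulus {f : Pt → ℝ} (hf : Measurable f) (s : ℝ) :
    Measurable fun q : ℝ × ℝ =>
      ENNReal.ofReal (gaussW (q.2, q.1, 0)) * moveModulus f (q.2, q.1, s) :=
  (continuous_gaussW.measurable.comp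
      (by fun_prop : Measurable fun q : ℝ × ℝ => ((q.2, q.1, 0) : Pt))).ennreal_ofReal.mul
    ((measurable_moveModulus hf).comp
      (by fun_prop : Measurable fun q : ℝ × ℝ => ((q.2, q.1, s) : Pt)))

lemma tendsto_gaussModulus {f : Pt → ℝ} (hf : Measurable f) (hfi : Integrable f) :
    Tendsto (gaussModulus f) (𝓝 0) (𝓝 0) := by
  have hm : ∀ s, Measurable fun q : ℝ × ℝ =>
      ENNReal.ofReal (gaussW (q.2, q.1, 0)) * moveModulus f (q.2, q.1, s) := 
    measurable_gauss_mul_modulus hf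
  have h1 : ∀ s, gaussModulus f s = ∫⁻ q : ℝ × ℝ,
      ENNReal.ofReal (gaussW (q.2, q.1, 0)) * moveModulus f (q.2, q.1, s) := fun s => by
    rw [Measure.volume_eq_prod, lintegral_prod _ (hm s).aemeasurable]; rfl
  have hg : Measurable fun q : ℝ × ℝ => ENNReal.ofReal (gaussW (q.2, q.1, 0)) :=
    (continuous_gaussW.measurable.comp (by fun_prop)).ennreal_ofReal
  have h2 : Tendsto (fun s => ∫⁻ q : ℝ × ℝ,
      ENNReal.ofReal (gaussW (q.2, q.1, 0)) * moveModulus f (q.2, q.1, s)) (𝓝 0)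
      (𝓝 (∫⁻ _ : ℝ × ℝ, 0)) := by
    -- The modulus never exceeds twice the `L¹` norm of `f`, and the Gaussian weight has mass one.
    refine tendsto_lintegral_filter_of_dominated_convergence
      (fun q => ENNReal.ofReal (gaussW (q.2, q.1, 0)) * (2 * ∫⁻ z, ‖f z‖ₑ))
      (Eventually.of_forall hm) (Eventually.of_forall fun s => Eventually.of_forall fun q => ?_)
      ?_ (Eventually.of_forall fun q => ?_)
    · exact mul_le_mul_right (moveModulus_le hf _) _
    · rw [lintegral_mul_const _ hg, Measure.volume_eq_prod, lintegral_prod _ hg.aemeasurable,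
        lintegral_gaussW, one_mul]
      exact ENNReal.mul_ne_top (by simp) hfi.2.ne
    · have := ENNReal.Tendsto.const_mul (tendsto_moveModulus hfi q.2 q.1)
        (a := ENNReal.ofReal (gaussW (q.2, q.1, 0))) (Or.inr ENNReal.ofReal_ne_top)
      simpa only [mul_zero] using this
  simp only [lintegral_zero] at h2
  exact h2.congr fun s => (h1 s).symm

/-- The pointwise error of the regularization by the kernel at elapsed times in `[ε, 2ε]`. -/
def mollifyError (f : Pt → ℝ) (ε : ℝ) (z : Pt) : ℝ≥0∞ :=
  ∫⁻ p, ENNReal.ofReal (deriv (ramp ε) p.2.2) * ENNReal.ofReal (gaussW p) *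
    ‖f (move z p) - f z‖ₑ

lemma measurable_mollifyError_integrand {f : Pt → ℝ} (hf : Measurable f) (ε : ℝ) :
    Measurable fun q : Pt × Pt => ENNReal.ofReal (deriv (ramp ε) q.2.2.2) *
      ENNReal.ofReal (gaussW q.2) * ‖f (move q.1 q.2) - f q.1‖ₑ :=
  (((continuous_deriv_ramp ε).measurable.comp (by fun_prop)).ennreal_ofReal.mul
    (continuous_gaussW.measurable.comp (by fun_prop)).ennreal_ofReal).mul (measurable_move_sub hf)

lemma measurable_mollifyError {f : Pt → ℝ} (hf : Measurable f) (ε : ℝ) :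
    Measurable (mollifyError f ε) :=
  (measurable_mollifyError_integrand hf ε).lintegral_prod_right'

lemma lintegral_mollifyError {f : Pt → ℝ} (hf : Measurable f) (ε : ℝ) :
    ∫⁻ z, mollifyError f ε z
      = ∫⁻ s, ENNReal.ofReal (deriv (ramp ε) s) * gaussModulus f s := by
  unfold mollifyError
  rw [lintegral_lintegral_swap (measurable_mollifyError_integrand hf ε).aemeasurable]
  have h1 : ∀ p : Pt, ∫⁻ z, ENNReal.ofReal (deriv (ramp ε) p.2.2) * ENNReal.ofReal (gaussW p) *
      ‖f (move z p) - f z‖ₑ = ENNReal.ofReal (deriv (ramp ε) p.2.2) *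
        (ENNReal.ofReal (gaussW p) * moveModulus f p) := by
    intro p
    have hm : Measurable fun z => ‖f (move z p) - f z‖ₑ :=
      ((hf.comp (measurable_move_left p)).sub hf).enorm
    rw [lintegral_const_mul _ hm, mul_assoc]
    rfl
  simp only [h1]
  have hm : Measurable fun p : Pt => ENNReal.ofReal (deriv (ramp ε) p.2.2) *
      (ENNReal.ofReal (gaussW p) * moveModulus f p) :=
    ((continuous_deriv_ramp ε).measurable.comp (by fun_prop)).ennreal_ofReal.mul
      (continuous_gaussW.measurable.ennreal_ofReal.mul (measurable_moveModulus hf))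
  rw [lintegral_pt _ hm]
  refine lintegral_congr fun s => ?_
  have hm2 : Measurable fun q : ℝ × ℝ =>
      ENNReal.ofReal (gaussW (q.2, q.1, 0)) * moveModulus f (q.2, q.1, s) :=
    measurable_gauss_mul_modulus hf s
  rw [gaussModulus, ← lintegral_const_mul _ hm2.lintegral_prod_right']
  refine lintegral_congr fun v => ?_
  have hm3 : Measurable fun u : ℝ =>
      ENNReal.ofReal (gaussW (u, v, 0)) * moveModulus f (u, v, s) :=
    (continuous_gaussW.measurable.comp
      (by fun_prop : Measurable fun u : ℝ => ((u, v, 0) : Pt))).ennreal_ofReal.mul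
    ((measurable_moveModulus hf).comp
      (by fun_prop : Measurable fun u : ℝ => ((u, v, s) : Pt)))
  rw [← lintegral_const_mul _ hm3]
  rfl

/-- The derivative of the ramp is a probability density on `[ε, 2ε]`, so the total error is an
average of `gaussModulus f` over those times. -/
lemma tendsto_lintegral_mollifyError {f : Pt → ℝ} (hf : Measurable f) (hfi : Integrable f) :
    Tendsto (fun ε => ∫⁻ z, mollifyError f ε z) (𝓝[>] 0) (𝓝 0) := by
  rw [ENNReal.tendsto_nhds_zero]
  intro δ hδ
  have h1 := (ENNReal.tendsto_nhds_zero.1 (tendsto_gaussModulus hf hfi)) δ hδ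
  obtain ⟨η, hη, h2⟩ := Metric.eventually_nhds_iff.1 h1
  filter_upwards [Ioo_mem_nhdsGT (half_pos hη)] with ε hε
  rw [lintegral_mollifyError hf]
  calc ∫⁻ s, ENNReal.ofReal (deriv (ramp ε) s) * gaussModulus f s
      ≤ ∫⁻ s, ENNReal.ofReal (deriv (ramp ε) s) * δ := by
        refine lintegral_mono fun s => ?_
        by_cases hs : s ∈ Set.Icc ε (2 * ε)
        · refine mul_le_mul_right (h2 ?_) _
          have := hε.1
          have := hε.2
          rw [Real.dist_eq, sub_zero, abs_of_pos (by linarith [hs.1])]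
          linarith [hs.2]
        · simp only [deriv_ramp_of_notMem hε.1 hs, ENNReal.ofReal_zero, zero_mul, le_refl]
    _ = δ := by
        rw [lintegral_mul_const _ (continuous_deriv_ramp ε).measurable.ennreal_ofReal,
          lintegral_deriv_ramp hε.1, one_mul]

/-- Fatou's lemma applied to convergence in `L¹`. A vanishing lower limit is enough for a one-sided
bound on `w`, so no almost everywhere convergent subsequence is extracted. -/
lemma ae_liminf_mollifyError {f : Pt → ℝ} (hf : Measurable f) (hfi : Integrable f) {e : ℕ → ℝ}
    (he : Tendsto e atTop (𝓝[>] 0)) :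
    ∀ᵐ z, liminf (fun n => mollifyError f (e n) z) atTop = 0 := by
  have h1 : ∫⁻ z, liminf (fun n => mollifyError f (e n) z) atTop = 0 := by
    refine le_antisymm ((lintegral_liminf_le fun n => measurable_mollifyError hf _).trans_eq ?_)
      zero_le
    exact ((tendsto_lintegral_mollifyError hf hfi).comp he).liminf_eq
  exact (lintegral_eq_zero_iff (.liminf fun n => measurable_mollifyError hf _)).1 h1

lemma lintegral_Γ₀_deriv_ramp {ε : ℝ} (hε : 0 < ε) {F : Pt → ℝ≥0∞} (hF : Measurable F) (z : Pt) :
    ∫⁻ ζ, ENNReal.ofReal (Γ₀ z ζ * deriv (ramp ε) (z.2.2 - ζ.2.2)) * F ζ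
      = ∫⁻ p, ENNReal.ofReal (deriv (ramp ε) p.2.2) * ENNReal.ofReal (gaussW p) *
        F (move z p) := by
  have hm : Measurable fun ζ => ENNReal.ofReal (Γ₀ z ζ * deriv (ramp ε) (z.2.2 - ζ.2.2)) * F ζ :=
    (((measurable_Γ₀_right z).mul
      ((continuous_deriv_ramp ε).measurable.comp (by fun_prop))).ennreal_ofReal).mul hF
  have hS : MeasurableSet {ζ : Pt | ζ.2.2 < z.2.2} :=
    measurableSet_lt measurable_snd.snd measurable_const
  have h1 : ∫⁻ ζ, ENNReal.ofReal (Γ₀ z ζ * deriv (ramp ε) (z.2.2 - ζ.2.2)) * F ζ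
      = ∫⁻ ζ in {ζ : Pt | ζ.2.2 < z.2.2},
        ENNReal.ofReal (Γ₀ z ζ * deriv (ramp ε) (z.2.2 - ζ.2.2)) * F ζ := by
    rw [← lintegral_indicator hS]
    refine lintegral_congr fun ζ => ?_
    rcases lt_or_ge ζ.2.2 z.2.2 with h | h
    · rw [Set.indicator_of_mem (by exact h)]
    · have h' : ζ ∉ {ζ : Pt | ζ.2.2 < z.2.2} := h.not_gt
      rw [Set.indicator_of_notMem h', Γ₀_of_le h, zero_mul,
        ENNReal.ofReal_zero, zero_mul]
  rw [h1, lintegral_move_right _ hm, ← lintegral_indicator measurableSet_posTime]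
  refine lintegral_congr fun p => ?_
  by_cases hp : p ∈ posTime
  · have hs : 0 < p.2.2 := hp
    have h2 : z.2.2 - (move z p).2.2 = p.2.2 := by simp [move]
    rw [Set.indicator_of_mem hp, Γ₀_move z hp, h2, ← mul_assoc, ← ENNReal.ofReal_mul (by positivity),
      ← ENNReal.ofReal_mul (deriv_ramp_nonneg hε _)]
    congr 2
    field_simp
  · have hs : p.2.2 ∉ Set.Icc ε (2 * ε) := fun h => hp (hε.trans_le h.1)
    rw [Set.indicator_of_notMem hp, deriv_ramp_of_notMem hε hs, ENNReal.ofReal_zero, zero_mul,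
      zero_mul]

lemma lintegral_Γ₀_deriv_ramp_one {ε : ℝ} (hε : 0 < ε) (z : Pt) :
    ∫⁻ ζ, ENNReal.ofReal (Γ₀ z ζ * deriv (ramp ε) (z.2.2 - ζ.2.2)) = 1 := by
  have h := lintegral_Γ₀_deriv_ramp hε (F := fun _ => 1) measurable_const z
  simp only [mul_one] at h
  rw [h, lintegral_time_profile (A := fun s => ENNReal.ofReal (deriv (ramp ε) s))
    (continuous_deriv_ramp ε).measurable.ennreal_ofReal
    continuous_gaussW.measurable.ennreal_ofReal (fun u v s => rfl), lintegral_deriv_ramp hε,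
    lintegral_gaussW, one_mul]

/-! ### Partial derivatives as derivatives along slices. -/

section Calculus

variable {f g : Pt → ℝ} {ζ : Pt}

lemma hasDerivAt_sliceX (hf : DifferentiableAt ℝ f ζ) :
    HasDerivAt (fun s => f (s, ζ.2.1, ζ.2.2)) (fderiv ℝ f ζ (1, 0, 0)) ζ.1 := by
  have h1 : HasDerivAt (fun s : ℝ => ((s, ζ.2.1, ζ.2.2) : Pt)) (1, 0, 0) ζ.1 :=
    (hasDerivAt_id _).prodMk ((hasDerivAt_const _ _).prodMk (hasDerivAt_const _ _))
  exact hf.hasFDerivAt.comp_hasDerivAt ζ.1 h1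

lemma hasDerivAt_sliceY (hf : DifferentiableAt ℝ f ζ) :
    HasDerivAt (fun s => f (ζ.1, s, ζ.2.2)) (fderiv ℝ f ζ (0, 1, 0)) ζ.2.1 := by
  have h1 : HasDerivAt (fun s : ℝ => ((ζ.1, s, ζ.2.2) : Pt)) (0, 1, 0) ζ.2.1 :=
    (hasDerivAt_const _ _).prodMk ((hasDerivAt_id _).prodMk (hasDerivAt_const _ _))
  exact hf.hasFDerivAt.comp_hasDerivAt ζ.2.1 h1

lemma hasDerivAt_sliceT (hf : DifferentiableAt ℝ f ζ) :
    HasDerivAt (fun s => f (ζ.1, ζ.2.1, s)) (fderiv ℝ f ζ (0, 0, 1)) ζ.2.2 := by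
  have h1 : HasDerivAt (fun s : ℝ => ((ζ.1, ζ.2.1, s) : Pt)) (0, 0, 1) ζ.2.2 :=
    (hasDerivAt_const _ _).prodMk ((hasDerivAt_const _ _).prodMk (hasDerivAt_id _))
  exact hf.hasFDerivAt.comp_hasDerivAt ζ.2.2 h1

lemma dX_eq_fderiv (hf : DifferentiableAt ℝ f ζ) : dX f ζ = fderiv ℝ f ζ (1, 0, 0) :=
  (hasDerivAt_sliceX hf).deriv

lemma dY_eq_fderiv (hf : DifferentiableAt ℝ f ζ) : dY f ζ = fderiv ℝ f ζ (0, 1, 0) :=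
  (hasDerivAt_sliceY hf).deriv

lemma dT_eq_fderiv (hf : DifferentiableAt ℝ f ζ) : dT f ζ = fderiv ℝ f ζ (0, 0, 1) :=
  (hasDerivAt_sliceT hf).deriv

lemma dX_mul (hf : DifferentiableAt ℝ f ζ) (hg : DifferentiableAt ℝ g ζ) :
    dX (fun z => f z * g z) ζ = dX f ζ * g ζ + f ζ * dX g ζ := by
  rw [dX_eq_fderiv hf, dX_eq_fderiv hg]
  exact ((hasDerivAt_sliceX hf).mul (hasDerivAt_sliceX hg)).deriv

lemma dY_mul (hf : DifferentiableAt ℝ f ζ) (hg : DifferentiableAt ℝ g ζ) :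
    dY (fun z => f z * g z) ζ = dY f ζ * g ζ + f ζ * dY g ζ := by
  rw [dY_eq_fderiv hf, dY_eq_fderiv hg]
  exact ((hasDerivAt_sliceY hf).mul (hasDerivAt_sliceY hg)).deriv

lemma dT_mul (hf : DifferentiableAt ℝ f ζ) (hg : DifferentiableAt ℝ g ζ) :
    dT (fun z => f z * g z) ζ = dT f ζ * g ζ + f ζ * dT g ζ := by
  rw [dT_eq_fderiv hf, dT_eq_fderiv hg]
  exact ((hasDerivAt_sliceT hf).mul (hasDerivAt_sliceT hg)).deriv

lemma contDiff_dX (hf : ContDiff ℝ ∞ f) : ContDiff ℝ ∞ (dX f) := by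
  have h : dX f = fun ζ => fderiv ℝ f ζ (1, 0, 0) :=
    funext fun ζ => dX_eq_fderiv (hf.differentiable (by simp) ζ)
  rw [h]
  exact (hf.fderiv_right (m := ∞) (by simp)).clm_apply contDiff_const

lemma contDiff_dY (hf : ContDiff ℝ ∞ f) : ContDiff ℝ ∞ (dY f) := by
  have h : dY f = fun ζ => fderiv ℝ f ζ (0, 1, 0) :=
    funext fun ζ => dY_eq_fderiv (hf.differentiable (by simp) ζ)
  rw [h]
  exact (hf.fderiv_right (m := ∞) (by simp)).clm_apply contDiff_const

lemma contDiff_dT (hf : ContDiff ℝ ∞ f) : ContDiff ℝ ∞ (dT f) := by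
  have h : dT f = fun ζ => fderiv ℝ f ζ (0, 0, 1) :=
    funext fun ζ => dT_eq_fderiv (hf.differentiable (by simp) ζ)
  rw [h]
  exact (hf.fderiv_right (m := ∞) (by simp)).clm_apply contDiff_const

lemma continuousAt_fderiv_apply (hf : ContDiffAt ℝ ∞ f ζ) (v : Pt) :
    ContinuousAt (fun ζ => fderiv ℝ f ζ v) ζ :=
  ((hf.fderiv_right (m := ∞) (by simp)).clm_apply contDiffAt_const).continuousAt

lemma eventually_differentiableAt (hf : ContDiffAt ℝ ∞ f ζ) :
    ∀ᶠ z in 𝓝 ζ, DifferentiableAt ℝ f z := by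
  have h1 : ContDiffAt ℝ 1 f ζ := hf.of_le (by exact_mod_cast le_top)
  filter_upwards [h1.eventually (by simp)] with z hz using hz.differentiableAt (by simp)

lemma continuousAt_dX (hf : ContDiffAt ℝ ∞ f ζ) : ContinuousAt (dX f) ζ :=
  (continuousAt_fderiv_apply hf (1, 0, 0)).congr
    ((eventually_differentiableAt hf).mono fun _ hz => (dX_eq_fderiv hz).symm)

lemma continuousAt_dY (hf : ContDiffAt ℝ ∞ f ζ) : ContinuousAt (dY f) ζ :=
  (continuousAt_fderiv_apply hf (0, 1, 0)).congr
    ((eventually_differentiableAt hf).mono fun _ hz => (dY_eq_fderiv hz).symm)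

lemma continuousAt_dT (hf : ContDiffAt ℝ ∞ f ζ) : ContinuousAt (dT f) ζ :=
  (continuousAt_fderiv_apply hf (0, 0, 1)).congr
    ((eventually_differentiableAt hf).mono fun _ hz => (dT_eq_fderiv hz).symm)

lemma tendsto_sliceX (ζ : Pt) : Tendsto (fun s => ((s, ζ.2.1, ζ.2.2) : Pt)) (𝓝 ζ.1) (𝓝 ζ) :=
  (by fun_prop : Continuous fun s : ℝ => ((s, ζ.2.1, ζ.2.2) : Pt)).continuousAt

lemma tendsto_sliceY (ζ : Pt) : Tendsto (fun s => ((ζ.1, s, ζ.2.2) : Pt)) (𝓝 ζ.2.1) (𝓝 ζ) :=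
  (by fun_prop : Continuous fun s : ℝ => ((ζ.1, s, ζ.2.2) : Pt)).continuousAt

lemma tendsto_sliceT (ζ : Pt) : Tendsto (fun s => ((ζ.1, ζ.2.1, s) : Pt)) (𝓝 ζ.2.2) (𝓝 ζ) :=
  (by fun_prop : Continuous fun s : ℝ => ((ζ.1, ζ.2.1, s) : Pt)).continuousAt

lemma dX_congr (h : f =ᶠ[𝓝 ζ] g) : dX f ζ = dX g ζ :=
  Filter.EventuallyEq.deriv_eq ((tendsto_sliceX ζ).eventually h)

lemma dY_congr (h : f =ᶠ[𝓝 ζ] g) : dY f ζ = dY g ζ :=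
  Filter.EventuallyEq.deriv_eq ((tendsto_sliceY ζ).eventually h)

lemma dT_congr (h : f =ᶠ[𝓝 ζ] g) : dT f ζ = dT g ζ :=
  Filter.EventuallyEq.deriv_eq ((tendsto_sliceT ζ).eventually h)

lemma dX_eq_zero_of_isLocalMin (h : IsLocalMin f ζ) : dX f ζ = 0 :=
  IsLocalMin.deriv_eq_zero ((tendsto_sliceX ζ).eventually h)

lemma dY_eq_zero_of_isLocalMin (h : IsLocalMin f ζ) : dY f ζ = 0 :=
  IsLocalMin.deriv_eq_zero ((tendsto_sliceY ζ).eventually h)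

lemma dT_eq_zero_of_isLocalMin (h : IsLocalMin f ζ) : dT f ζ = 0 :=
  IsLocalMin.deriv_eq_zero ((tendsto_sliceT ζ).eventually h)

end Calculus

/-! ### The regularized kernel and the adjoint equation. -/

section Kernel

lemma eventually_lt_time {z ζ : Pt} (h : ζ.2.2 < z.2.2) : ∀ᶠ ζ' : Pt in 𝓝 ζ, ζ'.2.2 < z.2.2 :=
  (by fun_prop : Continuous fun ζ : Pt => ζ.2.2).continuousAt.eventually (Iio_mem_nhds h)

lemma contDiffAt_Γ₀ {z ζ : Pt} (h : ζ.2.2 < z.2.2) : ContDiffAt ℝ ∞ (Γ₀ z) ζ := by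
  have hs : z.2.2 - ζ.2.2 ≠ 0 := (sub_pos.2 h).ne'
  have hpi := Real.pi_ne_zero
  refine ContDiffAt.congr_of_eventuallyEq (f := fun ζ : Pt =>
    Real.sqrt 3 / (2 * Real.pi * (z.2.2 - ζ.2.2) ^ 2) *
      Real.exp (- (z.2.1 - ζ.2.1) ^ 2 / (4 * (z.2.2 - ζ.2.2))
        - 3 / (z.2.2 - ζ.2.2) ^ 3 *
          (z.1 - ζ.1 - (z.2.2 - ζ.2.2) / 2 * (z.2.1 + ζ.2.1)) ^ 2)) ?_
    ((eventually_lt_time h).mono fun _ h' => Γ₀_of_lt h')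
  refine ContDiffAt.mul (ContDiffAt.div (by fun_prop) (by fun_prop) (by positivity))
    (ContDiffAt.exp (ContDiffAt.sub (ContDiffAt.div (by fun_prop) (by fun_prop) (by positivity))
      (ContDiffAt.mul (ContDiffAt.div (by fun_prop) (by fun_prop) (by positivity)) (by fun_prop))))

/-- The Kolmogorov kernel with its pole smoothly removed. -/
def regKernel (ε : ℝ) (z ζ : Pt) : ℝ := ramp ε (z.2.2 - ζ.2.2) * Γ₀ z ζ

lemma contDiff_timeRamp (ε : ℝ) (z : Pt) : ContDiff ℝ ∞ fun ζ : Pt => ramp ε (z.2.2 - ζ.2.2) :=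
  (contDiff_ramp ε).comp (by fun_prop)

lemma eventually_ramp_eq_zero {ε : ℝ} (hε : 0 < ε) {z ζ : Pt} (h : z.2.2 ≤ ζ.2.2) :
    ∀ᶠ ζ' : Pt in 𝓝 ζ, ramp ε (z.2.2 - ζ'.2.2) = 0 := by
  have h1 : ∀ᶠ ζ' : Pt in 𝓝 ζ, z.2.2 - ζ'.2.2 < ε :=
    (by fun_prop : Continuous fun ζ : Pt => z.2.2 - ζ.2.2).continuousAt.eventually
      (Iio_mem_nhds (by linarith))
  exact h1.mono fun _ h' => ramp_of_le hε (le_of_lt h')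

/-- Near any point with `τ ≥ t` the ramp is identically zero, so the pole of `Γ₀` is never met. -/
lemma contDiff_regKernel {ε : ℝ} (hε : 0 < ε) (z : Pt) : ContDiff ℝ ∞ (regKernel ε z) := by
  rw [contDiff_iff_contDiffAt]
  intro ζ
  rcases lt_or_ge ζ.2.2 z.2.2 with h | h
  · exact (contDiff_timeRamp ε z).contDiffAt.mul (contDiffAt_Γ₀ h)
  · refine (contDiffAt_const (c := (0 : ℝ))).congr_of_eventuallyEq
      ((eventually_ramp_eq_zero hε h).mono fun _ h' => ?_)
    simp only [regKernel, h', zero_mul]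

lemma regKernel_nonneg (ε : ℝ) (z ζ : Pt) : 0 ≤ regKernel ε z ζ :=
  mul_nonneg (ramp_nonneg _ _) (Γ₀_nonneg _ _)

/-- The ramp depends on `τ` alone, hence is a constant for the spatial derivatives. The identity
needs no differentiability of `Γ₀`. -/
lemma dY_regKernel (ε : ℝ) (z ζ : Pt) :
    dY (regKernel ε z) ζ = ramp ε (z.2.2 - ζ.2.2) * kolDY z ζ := by
  rw [← dY_Γ₀]
  simp only [dY, regKernel]
  exact deriv_const_mul_field _

lemma dX_regKernel (ε : ℝ) (z ζ : Pt) :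
    dX (regKernel ε z) ζ = ramp ε (z.2.2 - ζ.2.2) * dX (Γ₀ z) ζ := by
  simp only [dX, regKernel]
  exact deriv_const_mul_field _

lemma dY_dY_regKernel (ε : ℝ) (z ζ : Pt) :
    dY (dY (regKernel ε z)) ζ = ramp ε (z.2.2 - ζ.2.2) * dY (kolDY z) ζ := by
  have h : dY (regKernel ε z) = fun ζ => ramp ε (z.2.2 - ζ.2.2) * kolDY z ζ :=
    funext fun ζ => dY_regKernel ε z ζ
  rw [h]
  simp only [dY]
  exact deriv_const_mul_field _

lemma dT_regKernel (ε : ℝ) {z ζ : Pt} (h : ζ.2.2 < z.2.2) :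
    dT (regKernel ε z) ζ = ramp ε (z.2.2 - ζ.2.2) * dT (Γ₀ z) ζ
      - deriv (ramp ε) (z.2.2 - ζ.2.2) * Γ₀ z ζ := by
  have h1 : dT (fun ζ : Pt => ramp ε (z.2.2 - ζ.2.2)) ζ = - deriv (ramp ε) (z.2.2 - ζ.2.2) :=
    deriv_comp_const_sub (ramp ε) z.2.2 ζ.2.2
  have h2 := dT_mul ((contDiff_timeRamp ε z).differentiable (by simp) ζ)
    ((contDiffAt_Γ₀ h).differentiableAt (by simp))
  rw [h1] at h2
  refine h2.trans (by ring)

lemma dX_Γ₀ {z ζ : Pt} (h : ζ.2.2 < z.2.2) : dX (Γ₀ z) ζ = Γ₀ z ζ *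
    (6 / (z.2.2 - ζ.2.2) ^ 3 * (z.1 - ζ.1 - (z.2.2 - ζ.2.2) / 2 * (z.2.1 + ζ.2.1))) := by
  have hs : 0 < z.2.2 - ζ.2.2 := sub_pos.2 h
  have hE : HasDerivAt (fun s : ℝ => - (z.2.1 - ζ.2.1) ^ 2 / (4 * (z.2.2 - ζ.2.2))
      - 3 / (z.2.2 - ζ.2.2) ^ 3 *
        (z.1 - s - (z.2.2 - ζ.2.2) / 2 * (z.2.1 + ζ.2.1)) ^ 2)
      (6 / (z.2.2 - ζ.2.2) ^ 3 * (z.1 - ζ.1 - (z.2.2 - ζ.2.2) / 2 * (z.2.1 + ζ.2.1))) ζ.1 := by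
    have h2 := (((((hasDerivAt_id ζ.1).const_sub z.1).sub_const
      ((z.2.2 - ζ.2.2) / 2 * (z.2.1 + ζ.2.1))).pow 2).const_mul (3 / (z.2.2 - ζ.2.2) ^ 3)).const_sub
        (- (z.2.1 - ζ.2.1) ^ 2 / (4 * (z.2.2 - ζ.2.2)))
    refine h2.congr_deriv ?_
    simp only [id]
    field_simp
    ring
  have h3 := (hE.exp).const_mul (Real.sqrt 3 / (2 * Real.pi * (z.2.2 - ζ.2.2) ^ 2))
  have h4 : (fun s => Γ₀ z (s, ζ.2.1, ζ.2.2)) = fun s =>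
      Real.sqrt 3 / (2 * Real.pi * (z.2.2 - ζ.2.2) ^ 2) *
      Real.exp (- (z.2.1 - ζ.2.1) ^ 2 / (4 * (z.2.2 - ζ.2.2))
      - 3 / (z.2.2 - ζ.2.2) ^ 3 *
        (z.1 - s - (z.2.2 - ζ.2.2) / 2 * (z.2.1 + ζ.2.1)) ^ 2) := by
    funext s; exact Γ₀_of_lt h
  rw [dX, h4, h3.deriv, Γ₀_of_lt h]
  ring

/-- The parameters stand for `y - η`, `x - ξ` and `y + η`, which are fixed while the elapsed time
`σ` varies. -/
lemma hasDerivAt_kernel_time (b c e : ℝ) {σ : ℝ} (hσ : 0 < σ) :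
    HasDerivAt (fun σ : ℝ => √3 / (2 * Real.pi * σ ^ 2) *
      Real.exp (- b ^ 2 / (4 * σ) - 3 / σ ^ 3 * (c - σ / 2 * e) ^ 2))
      (√3 / (2 * Real.pi * σ ^ 2) *
      Real.exp (- b ^ 2 / (4 * σ) - 3 / σ ^ 3 * (c - σ / 2 * e) ^ 2) *
        (- 2 / σ + b ^ 2 / (4 * σ ^ 2) + 9 / σ ^ 4 * (c - σ / 2 * e) ^ 2
          + 3 / σ ^ 3 * (c - σ / 2 * e) * e)) σ := by
  have hpi := Real.pi_pos
  have hP : HasDerivAt (fun σ : ℝ => √3 / (2 * Real.pi * σ ^ 2))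
      (√3 / (2 * Real.pi * σ ^ 2) * (- 2 / σ)) σ := by
    have h1 : HasDerivAt (fun σ : ℝ => 2 * Real.pi * σ ^ 2) (2 * Real.pi * (2 * σ)) σ := by
      simpa using (hasDerivAt_pow 2 σ).const_mul (2 * Real.pi)
    have h2 := (hasDerivAt_const σ √3).fun_div h1 (by positivity)
    refine h2.congr_deriv ?_
    field_simp
    ring
  have hE1 : HasDerivAt (fun σ : ℝ => - b ^ 2 / (4 * σ)) (b ^ 2 / (4 * σ ^ 2)) σ := by
    have h1 : HasDerivAt (fun σ : ℝ => 4 * σ) 4 σ := by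
      simpa using (hasDerivAt_id σ).const_mul 4
    have h2 := (hasDerivAt_const σ (- b ^ 2)).fun_div h1 (by positivity)
    refine h2.congr_deriv ?_
    field_simp
    ring
  have hE2 : HasDerivAt (fun σ : ℝ => 3 / σ ^ 3) (- 9 / σ ^ 4) σ := by
    have h1 : HasDerivAt (fun σ : ℝ => σ ^ 3) (3 * σ ^ 2) σ := by
      simpa using hasDerivAt_pow 3 σ
    have h2 := (hasDerivAt_const σ 3).fun_div h1 (by positivity)
    refine h2.congr_deriv ?_
    field_simp
    ring
  have hE3 : HasDerivAt (fun σ : ℝ => (c - σ / 2 * e) ^ 2) (- (c - σ / 2 * e) * e) σ := by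
    have h1 : HasDerivAt (fun σ : ℝ => c - σ / 2 * e) (- (1 / 2 * e)) σ :=
      (((hasDerivAt_id σ).div_const 2).mul_const e).const_sub c
    have h2 := h1.fun_pow 2
    refine h2.congr_deriv ?_
    simp only [Nat.cast_ofNat, Nat.add_one_sub_one, pow_one]
    ring
  refine (hP.mul (hE1.sub (hE2.mul hE3)).exp).congr_deriv ?_
  simp only [Pi.mul_apply, Pi.sub_apply]
  ring

lemma dT_Γ₀ {z ζ : Pt} (h : ζ.2.2 < z.2.2) : dT (Γ₀ z) ζ = Γ₀ z ζ *
    (2 / (z.2.2 - ζ.2.2) - (z.2.1 - ζ.2.1) ^ 2 / (4 * (z.2.2 - ζ.2.2) ^ 2)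
      - 9 / (z.2.2 - ζ.2.2) ^ 4 * (z.1 - ζ.1 - (z.2.2 - ζ.2.2) / 2 * (z.2.1 + ζ.2.1)) ^ 2
      - 3 / (z.2.2 - ζ.2.2) ^ 3 * (z.1 - ζ.1 - (z.2.2 - ζ.2.2) / 2 * (z.2.1 + ζ.2.1))
        * (z.2.1 + ζ.2.1)) := by
  have hs : 0 < z.2.2 - ζ.2.2 := sub_pos.2 h
  have h1 := hasDerivAt_kernel_time (z.2.1 - ζ.2.1) (z.1 - ζ.1) (z.2.1 + ζ.2.1) hs
  have h2 := h1.comp_const_sub z.2.2 ζ.2.2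
  have h3 := h2.congr_of_eventuallyEq (f₁ := fun s => Γ₀ z (ζ.1, ζ.2.1, s)) (by
    filter_upwards [Iio_mem_nhds h] with s hs'
    exact Γ₀_of_lt hs')
  rw [dT, h3.deriv, Γ₀_of_lt h]
  ring

lemma dY_kolDY {z ζ : Pt} (h : ζ.2.2 < z.2.2) : dY (kolDY z) ζ = Γ₀ z ζ *
    (((z.2.1 - ζ.2.1) / (2 * (z.2.2 - ζ.2.2)) + 3 / (z.2.2 - ζ.2.2) ^ 2 *
      (z.1 - ζ.1 - (z.2.2 - ζ.2.2) / 2 * (z.2.1 + ζ.2.1))) ^ 2 - 2 / (z.2.2 - ζ.2.2)) := by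
  have hs : 0 < z.2.2 - ζ.2.2 := sub_pos.2 h
  have h1 : HasDerivAt (fun s => Γ₀ z (ζ.1, s, ζ.2.2)) (kolDY z ζ) ζ.2.1 := by
    rw [← dY_Γ₀, dY_eq_fderiv ((contDiffAt_Γ₀ h).differentiableAt (by simp))]
    exact hasDerivAt_sliceY ((contDiffAt_Γ₀ h).differentiableAt (by simp))
  have h2 : HasDerivAt (fun s => (z.2.1 - s) / (2 * (z.2.2 - ζ.2.2)) + 3 / (z.2.2 - ζ.2.2) ^ 2 *
      (z.1 - ζ.1 - (z.2.2 - ζ.2.2) / 2 * (z.2.1 + s))) (- 2 / (z.2.2 - ζ.2.2)) ζ.2.1 := by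
    have h3 := ((hasDerivAt_id ζ.2.1).const_sub z.2.1).div_const (2 * (z.2.2 - ζ.2.2))
    have h4 := ((((hasDerivAt_id ζ.2.1).const_add z.2.1).const_mul
        ((z.2.2 - ζ.2.2) / 2)).const_sub (z.1 - ζ.1)).const_mul (3 / (z.2.2 - ζ.2.2) ^ 2)
    refine (h3.add h4).congr_deriv ?_
    field_simp
    ring
  have h5 := (h1.mul h2).deriv
  refine h5.trans ?_
  rw [kolDY]
  ring

/-- The regularized kernel solves the adjoint Kolmogorov equation away from the cut. -/
lemma regKernel_adjoint {ε : ℝ} (hε : 0 < ε) (z ζ : Pt) :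
    dT (regKernel ε z) ζ + ζ.2.1 * dX (regKernel ε z) ζ + dY (dY (regKernel ε z)) ζ
      = - (Γ₀ z ζ * deriv (ramp ε) (z.2.2 - ζ.2.2)) := by
  rcases lt_or_ge ζ.2.2 z.2.2 with h | h
  · have hs : 0 < z.2.2 - ζ.2.2 := sub_pos.2 h
    rw [dT_regKernel ε h, dX_regKernel, dY_dY_regKernel, dT_Γ₀ h, dX_Γ₀ h, dY_kolDY h]
    -- The logarithmic derivatives of the kernel cancel as a rational identity; only the derivative
    -- of the ramp survives.
    field_simp
    ring
  · have h1 := eventually_ramp_eq_zero hε h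
    have h2 : regKernel ε z =ᶠ[𝓝 ζ] fun _ => 0 := h1.mono fun _ h' => by
      simp only [regKernel, h', zero_mul]
    have h3 : dT (regKernel ε z) ζ = 0 := by rw [dT_congr h2]; simp [dT]
    rw [h3, dX_regKernel, dY_dY_regKernel, h1.self_of_nhds, Γ₀_of_le h]
    simp

end Kernel

/-! ### Properties of the cut-off. -/

section Cutoff

variable {θ r M : ℝ} {m : ℝ → ℝ → ℝ} {χ : ℝ → ℝ}

lemma rpow_sixth_lt_half (hθ : 0 < θ) (hθ' : θ < (2 : ℝ)⁻¹ ^ 6) : θ ^ ((1 : ℝ) / 6) < 1 / 2 := by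
  have h := Real.rpow_lt_rpow hθ.le hθ' (by norm_num : (0 : ℝ) < 1 / 6)
  refine h.trans_eq ?_
  rw [← Real.rpow_natCast, ← Real.rpow_mul (by norm_num)]
  norm_num

lemma pow_six_rpow_sixth (hr : 0 ≤ r) : (r ^ 6) ^ ((1 : ℝ) / 6) = r := by
  rw [← Real.rpow_natCast, ← Real.rpow_mul hr]
  norm_num

lemma IsCutoff.contDiffAt (h : IsCutoff θ r M m χ) {s : ℝ} (hs : 0 < s) : ContDiffAt ℝ ∞ χ s :=
  h.smooth.contDiffAt (Ici_mem_nhds hs)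

lemma IsCutoff.apply_self (h : IsCutoff θ r M m χ) (hr : 0 < r) : χ r = 0 := by
  have h1 : Tendsto χ (𝓝[>] r) (𝓝 (χ r)) :=
    (h.contDiffAt hr).continuousAt.tendsto.mono_left nhdsWithin_le_nhds
  have h2 : Tendsto χ (𝓝[>] r) (𝓝 0) := by
    refine tendsto_const_nhds.congr' ?_
    filter_upwards [self_mem_nhdsWithin] with s hs using (h.eq_zero s hs).symm
  exact tendsto_nhds_unique h1 h2

lemma IsCutoff.mem_Icc (h : IsCutoff θ r M m χ) (hr : 0 < r) {s : ℝ} (hs : 0 ≤ s) :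
    χ s ∈ Set.Icc 0 1 := by
  rcases lt_trichotomy s r with h1 | rfl | h1
  · exact ⟨(h.pos_le_one s hs h1).1.le, (h.pos_le_one s hs h1).2⟩
  · rw [h.apply_self hr]; simp
  · rw [h.eq_zero s h1]; simp

lemma IsCutoff.lt_of_ne_zero (h : IsCutoff θ r M m χ) (hr : 0 < r) {s : ℝ} (hs : χ s ≠ 0) :
    s < r := by
  by_contra! h1
  rcases h1.eq_or_lt with rfl | h2
  · exact hs (h.apply_self hr)
  · exact hs (h.eq_zero s h2)

lemma cutoff_base_pos (θ : ℝ) (hr : 0 < r) {ζ : Pt} (hζ : ζ.2.2 < 0) :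
    0 < θ ^ 2 * ζ.1 ^ 2 - 6 * ζ.2.2 * r ^ 4 := by
  have := mul_pos (neg_pos.2 hζ) (pow_pos hr 4)
  nlinarith [sq_nonneg (θ * ζ.1)]

/-- Two points could spoil smoothness. The sixth root is safe because `τ < 0` makes its base
positive, and the corner of `|η|` is safe because `χ` equals one near zero. -/
lemma contDiffAt_cutoff (hθ : 0 < θ) (hr : 0 < r) (h : IsCutoff θ r M m χ) {ζ : Pt}
    (hζ : ζ.2.2 < 0) : ContDiffAt ℝ ∞ (cutoff θ r χ) ζ := by
  have hb := cutoff_base_pos θ hr hζ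
  unfold cutoff
  refine ContDiffAt.mul ?_ ?_
  · have h1 : ContDiffAt ℝ ∞ (fun z : Pt =>
        (θ ^ 2 * z.1 ^ 2 - 6 * z.2.2 * r ^ 4) ^ ((1 : ℝ) / 6)) ζ :=
      ContDiffAt.rpow_const_of_ne (by fun_prop) hb.ne'
    exact (h.contDiffAt (Real.rpow_pos_of_pos hb _)).comp ζ h1
  · by_cases hy : ζ.2.1 = 0
    · have h1 : (fun z : Pt => χ (θ * |z.2.1|)) =ᶠ[𝓝 ζ] fun _ => 1 := by
        have hc : Continuous fun z : Pt => θ * |z.2.1| := by fun_prop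
        have h2 : ∀ᶠ z : Pt in 𝓝 ζ, θ * |z.2.1| < θ ^ ((1 : ℝ) / 6) * r := by
          refine hc.continuousAt.eventually (Iio_mem_nhds ?_)
          simp only [hy, abs_zero, mul_zero]
          positivity
        exact h2.mono fun z hz => h.eq_one _ (by positivity) hz.le
      exact contDiffAt_const.congr_of_eventuallyEq h1
    · have h1 : ContDiffAt ℝ ∞ (fun z : Pt => θ * |z.2.1|) ζ := by
        refine contDiffAt_const.mul ?_
        have h3 : ContDiffAt ℝ ∞ (fun z : Pt => z.2.1) ζ := by fun_prop
        have h4 : ContDiffAt ℝ ∞ (fun x : ℝ => |x|) ζ.2.1 := contDiffAt_abs hy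
        exact h4.comp ζ h3
      exact (h.contDiffAt (mul_pos hθ (abs_pos.2 hy))).comp ζ h1

lemma cutoff_mem_Icc (hθ : 0 < θ) (hr : 0 < r) (h : IsCutoff θ r M m χ) {ζ : Pt}
    (hζ : ζ.2.2 < 0) : cutoff θ r χ ζ ∈ Set.Icc 0 1 := by
  have hb := cutoff_base_pos θ hr hζ
  have h1 := h.mem_Icc hr (Real.rpow_nonneg hb.le ((1 : ℝ) / 6))
  have h2 := h.mem_Icc hr (mul_nonneg hθ.le (abs_nonneg ζ.2.1))
  exact ⟨mul_nonneg h1.1 h2.1, mul_le_one₀ h1.2 h2.1 h2.2⟩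

/-- The closed box carrying the cut-off. -/
def cutoffBox (θ r : ℝ) : Set Pt :=
  Set.Icc (-(r ^ 3 / θ)) (r ^ 3 / θ) ×ˢ (Set.Icc (-(r / θ)) (r / θ) ×ˢ Set.Icc (-r ^ 2) 0)

/-- A nonzero first factor forces `θ²ξ² + 6|τ|r⁴ < r⁶`; each bound follows by discarding one of the
two nonnegative terms. The second factor bounds `|η|`. -/
lemma cutoff_support (hθ : 0 < θ) (hr : 0 < r) (h : IsCutoff θ r M m χ) {ζ : Pt}
    (hζ : ζ.2.2 < 0) (hne : cutoff θ r χ ζ ≠ 0) :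
    |ζ.1| < r ^ 3 / θ ∧ |ζ.2.1| < r / θ ∧ - r ^ 2 < ζ.2.2 := by
  have hb := cutoff_base_pos θ hr hζ
  have h1 := h.lt_of_ne_zero hr (left_ne_zero_of_mul hne)
  have h2 := h.lt_of_ne_zero hr (right_ne_zero_of_mul hne)
  have h3 : θ ^ 2 * ζ.1 ^ 2 - 6 * ζ.2.2 * r ^ 4 < r ^ 6 := by
    by_contra! h4
    have := Real.rpow_le_rpow (by positivity) h4 (by norm_num : (0 : ℝ) ≤ 1 / 6)
    rw [pow_six_rpow_sixth hr.le] at this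
    linarith
  have h4 := mul_pos (neg_pos.2 hζ) (pow_pos hr 4)
  refine ⟨?_, ?_, ?_⟩
  · rw [lt_div_iff₀ hθ]
    refine lt_of_pow_lt_pow_left₀ 2 (by positivity) ?_
    rw [mul_pow, sq_abs]
    nlinarith
  · rw [lt_div_iff₀ hθ]; linarith
  · have h5 : 0 < r ^ 4 := by positivity
    have h6 : -ζ.2.2 * r ^ 4 < r ^ 2 * r ^ 4 := by nlinarith [sq_nonneg (θ * ζ.1)]
    have := lt_of_mul_lt_mul_right h6 h5.le
    linarith

lemma cutoff_eq_zero_of_notMem (hθ : 0 < θ) (hr : 0 < r) (h : IsCutoff θ r M m χ) {ζ : Pt}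
    (hζ : ζ.2.2 < 0) (hn : ζ ∉ cutoffBox θ r) : cutoff θ r χ ζ = 0 := by
  by_contra hne
  obtain ⟨h1, h2, h3⟩ := cutoff_support hθ hr h hζ hne
  exact hn ⟨⟨(abs_lt.1 h1).1.le, (abs_lt.1 h1).2.le⟩, ⟨(abs_lt.1 h2).1.le, (abs_lt.1 h2).2.le⟩,
    h3.le, hζ.le⟩

lemma mem_Bminus_of_cutoff_ne_zero (hθ : 0 < θ) (hθ1 : θ < 1) (hr : 0 < r)
    (h : IsCutoff θ r M m χ) {ζ : Pt} (hζ : ζ.2.2 < 0) (hne : cutoff θ r χ ζ ≠ 0) :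
    ζ ∈ Bminus (r / θ) := by
  obtain ⟨h1, h2, h3⟩ := cutoff_support hθ hr h hζ hne
  refine ⟨h1.trans_le ?_, h2, ?_, hζ⟩
  · rw [div_pow]
    refine div_le_div_of_nonneg_left (by positivity) (by positivity) ?_
    calc θ ^ 3 ≤ θ ^ 1 := pow_le_pow_of_le_one hθ.le hθ1.le (by norm_num)
      _ = θ := pow_one θ
  · have : r ^ 2 ≤ (r / θ) ^ 2 := by
      refine pow_le_pow_left₀ hr.le ?_ 2
      rw [le_div_iff₀ hθ]; nlinarith
    linarith

/-- The cut-off is nonnegative for negative times, so its zeros are minima and its first derivatives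
vanish there. This replaces a discussion of the boundary of the support. -/
lemma isLocalMin_cutoff (hθ : 0 < θ) (hr : 0 < r) (h : IsCutoff θ r M m χ) {ζ : Pt}
    (hζ : ζ.2.2 < 0) (h0 : cutoff θ r χ ζ = 0) : IsLocalMin (cutoff θ r χ) ζ := by
  have h1 : ∀ᶠ z : Pt in 𝓝 ζ, z.2.2 < 0 :=
    (by fun_prop : Continuous fun ζ : Pt => ζ.2.2).continuousAt.eventually (Iio_mem_nhds hζ)
  exact h1.mono fun z hz => by
    show cutoff θ r χ ζ ≤ cutoff θ r χ z
    rw [h0]; exact (cutoff_mem_Icc hθ hr h hz).1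

/-- The bound on `θ` gives `θ^{1/6} < 1/2`, so `|χ'| ≤ 4/r`; the remaining `θ` is the inner
derivative of `θ|η|`. -/
lemma abs_dY_cutoff_le (hθ : 0 < θ) (hθ' : θ < (2 : ℝ)⁻¹ ^ 6) (hr : 0 < r)
    (h : IsCutoff θ r M m χ) {ζ : Pt} (hζ : ζ.2.2 < 0) :
    |dY (cutoff θ r χ) ζ| ≤ 4 * θ / r := by
  have hb := cutoff_base_pos θ hr hζ
  have h1 := h.mem_Icc hr (Real.rpow_nonneg hb.le ((1 : ℝ) / 6))
  have hs := rpow_sixth_lt_half hθ hθ'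
  have hd : dY (cutoff θ r χ) ζ = χ ((θ ^ 2 * ζ.1 ^ 2 - 6 * ζ.2.2 * r ^ 4) ^ ((1 : ℝ) / 6)) *
      deriv (fun s => χ (θ * |s|)) ζ.2.1 := by
    simp only [dY, cutoff]
    exact deriv_const_mul_field _
  have h2 : |deriv (fun s => χ (θ * |s|)) ζ.2.1| ≤ 4 * θ / r := by
    by_cases hy : ζ.2.1 = 0
    · have h3 : (fun s => χ (θ * |s|)) =ᶠ[𝓝 ζ.2.1] fun _ => 1 := by
        have hc : Continuous fun s : ℝ => θ * |s| := by fun_prop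
        have h4 : ∀ᶠ s : ℝ in 𝓝 ζ.2.1, θ * |s| < θ ^ ((1 : ℝ) / 6) * r := by
          refine hc.continuousAt.eventually (Iio_mem_nhds ?_)
          simp only [hy, abs_zero, mul_zero]
          positivity
        exact h4.mono fun z hz => h.eq_one _ (by positivity) hz.le
      rw [h3.deriv_eq, deriv_const, abs_zero]
      positivity
    · have hpos : 0 < θ * |ζ.2.1| := mul_pos hθ (abs_pos.2 hy)
      have h3 : HasDerivAt χ (deriv χ (θ * |ζ.2.1|)) (θ * |ζ.2.1|) :=
        ((h.contDiffAt hpos).differentiableAt (by simp)).hasDerivAt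
      have h4 := (hasDerivAt_abs hy).const_mul θ
      have h5 := (h3.comp ζ.2.1 h4).deriv
      have h6 : deriv (fun s => χ (θ * |s|)) ζ.2.1
          = deriv χ (θ * |ζ.2.1|) * (θ * (SignType.sign ζ.2.1 : ℝ)) := h5
      obtain ⟨h7, h8⟩ := h.deriv_bound _ hpos
      have h9 : 2 / ((1 - θ ^ ((1 : ℝ) / 6)) * r) ≤ 4 / r := by
        rw [div_le_div_iff₀ (by nlinarith) hr]
        nlinarith
      have h10 : |(SignType.sign ζ.2.1 : ℝ)| ≤ 1 := by
        rcases lt_or_gt_of_ne hy with h11 | h11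
        · simp [sign_neg h11]
        · simp [sign_pos h11]
      rw [h6, abs_mul, abs_mul, abs_of_pos hθ]
      have h12 : |deriv χ (θ * |ζ.2.1|)| ≤ 4 / r := by
        rw [← abs_neg, abs_of_nonneg h7]; linarith
      calc |deriv χ (θ * |ζ.2.1|)| * (θ * |(SignType.sign ζ.2.1 : ℝ)|)
          ≤ 4 / r * (θ * 1) := by gcongr
        _ = 4 * θ / r := by ring
  rw [hd, abs_mul, abs_of_nonneg h1.1]
  exact (mul_le_of_le_one_left (abs_nonneg _) h1.2).trans h2

lemma cutoff_eq_one (hθ : 0 < θ) (hθ' : θ < (2 : ℝ)⁻¹ ^ 6) (hr : 0 < r)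
    (h : IsCutoff θ r M m χ) {ζ : Pt} (hζ : ζ ∈ Bminus (θ * r)) : cutoff θ r χ ζ = 1 := by
  obtain ⟨h1, h2, h3, h4⟩ := hζ
  have hb := cutoff_base_pos θ hr h4
  have hθ1 : θ < 1 / 64 := hθ'.trans_eq (by norm_num)
  have hx : ζ.1 ^ 2 ≤ ((θ * r) ^ 3) ^ 2 := by
    rw [← sq_abs ζ.1]
    exact pow_le_pow_left₀ (abs_nonneg _) h1.le 2
  have e1 : χ ((θ ^ 2 * ζ.1 ^ 2 - 6 * ζ.2.2 * r ^ 4) ^ ((1 : ℝ) / 6)) = 1 := by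
    refine h.eq_one _ (Real.rpow_nonneg hb.le _) ?_
    rw [← pow_six_rpow_sixth hr.le, ← Real.mul_rpow hθ.le (by positivity), pow_six_rpow_sixth hr.le]
    refine Real.rpow_le_rpow hb.le ?_ (by norm_num)
    have h5 : θ ^ 2 * ζ.1 ^ 2 ≤ θ ^ 8 * r ^ 6 := by
      calc θ ^ 2 * ζ.1 ^ 2 ≤ θ ^ 2 * ((θ * r) ^ 3) ^ 2 := by gcongr
        _ = θ ^ 8 * r ^ 6 := by ring
    have h6 : - ζ.2.2 * r ^ 4 ≤ θ ^ 2 * r ^ 6 := by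
      calc - ζ.2.2 * r ^ 4 ≤ (θ * r) ^ 2 * r ^ 4 := by gcongr; linarith
        _ = θ ^ 2 * r ^ 6 := by ring
    have h7 : θ ^ 8 ≤ θ ^ 2 := pow_le_pow_of_le_one hθ.le (by linarith) (by norm_num)
    -- The base is at most `(θ⁸ + 6θ²) r⁶ ≤ 7θ² r⁶`, and this must not exceed `θ r⁶`; `θ < 1/64`
    -- leaves ample room.
    have h8 : 7 * θ ^ 2 ≤ θ := by nlinarith
    have h9 : 0 < r ^ 6 := by positivity
    nlinarith
  have e2 : χ (θ * |ζ.2.1|) = 1 := by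
    refine h.eq_one _ (by positivity) ?_
    have h5 : θ ≤ θ ^ ((1 : ℝ) / 6) := by
      conv_lhs => rw [← Real.rpow_one θ]
      exact Real.rpow_le_rpow_of_exponent_ge hθ (by linarith) (by norm_num)
    have h6 : |ζ.2.1| ≤ r := h2.le.trans (by nlinarith)
    gcongr
  rw [cutoff, e1, e2, one_mul]

end Cutoff

/-! ### Testing the inequality with the localized regularized kernel. -/

section Localization

variable {θ r M Λ T : ℝ} {m : ℝ → ℝ → ℝ} {χ : ℝ → ℝ} {a w wy : Pt → ℝ}

/-- The part of the cut-off box up to time `T`. -/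
def pastBox (θ r T : ℝ) : Set Pt := cutoffBox θ r ∩ {ζ | ζ.2.2 ≤ T}

lemma isCompact_pastBox (θ r T : ℝ) : IsCompact (pastBox θ r T) :=
  (isCompact_Icc.prod (isCompact_Icc.prod isCompact_Icc)).inter_right
    (isClosed_le (by fun_prop : Continuous fun ζ : Pt => ζ.2.2) continuous_const)

lemma pastBox_subset (hθ : 0 < θ) (hθ1 : θ < 1) (hr : 0 < r) (hrθ : r < θ) (hT : T < 0) :
    pastBox θ r T ⊆ Bminus 1 := by
  rintro ζ ⟨⟨⟨h1, h2⟩, ⟨h3, h4⟩, h5, -⟩, h6⟩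
  have hr1 : r / θ < 1 := (div_lt_one hθ).2 hrθ
  have hr2 : r ^ 2 < 1 := by nlinarith
  have hr3 : r ^ 3 / θ < 1 := by
    rw [div_lt_one hθ]
    nlinarith [sq_nonneg r]
  refine ⟨?_, ?_, ?_, lt_of_le_of_lt h6 hT⟩
  · rw [one_pow, abs_lt]; constructor <;> linarith
  · rw [abs_lt]; constructor <;> linarith
  · rw [one_pow]; linarith

lemma isOpen_Bminus (ρ : ℝ) : IsOpen (Bminus ρ) := by
  have h1 : IsOpen {z : Pt | |z.1| < ρ ^ 3} := isOpen_lt (by fun_prop) (by fun_prop)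
  have h2 : IsOpen {z : Pt | |z.2.1| < ρ} := isOpen_lt (by fun_prop) (by fun_prop)
  have h3 : IsOpen {z : Pt | -ρ ^ 2 < z.2.2} := isOpen_lt (by fun_prop) (by fun_prop)
  have h4 : IsOpen {z : Pt | z.2.2 < 0} := isOpen_lt (by fun_prop) (by fun_prop)
  exact h1.inter (h2.inter (h3.inter h4))

lemma Bminus_subset {ρ σ : ℝ} (hρ : 0 ≤ ρ) (h : ρ ≤ σ) : Bminus ρ ⊆ Bminus σ := by
  rintro z ⟨h1, h2, h3, h4⟩
  have h5 : ρ ^ 3 ≤ σ ^ 3 := pow_le_pow_left₀ hρ h 3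
  have h6 : ρ ^ 2 ≤ σ ^ 2 := pow_le_pow_left₀ hρ h 2
  exact ⟨by linarith, by linarith, by linarith, h4⟩

lemma cutoff_mul_eq_zero (hθ : 0 < θ) (hr : 0 < r) (h : IsCutoff θ r M m χ) (hT : T < 0)
    {g : Pt → ℝ} (hg : ∀ ζ : Pt, T ≤ ζ.2.2 → g ζ = 0) {ζ : Pt} (hζ : ζ ∉ pastBox θ r T) :
    cutoff θ r χ ζ * g ζ = 0 := by
  rcases le_or_gt T ζ.2.2 with h1 | h1
  · rw [hg ζ h1, mul_zero]
  · rw [cutoff_eq_zero_of_notMem hθ hr h (h1.trans hT) fun h2 => hζ ⟨h2, h1.le⟩, zero_mul]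

/-- The cut-off is controlled only for negative times. A factor vanishing from some time `T < 0`
onwards hides its behaviour at and after time zero. -/
lemma contDiff_cutoff_mul (hθ : 0 < θ) (hr : 0 < r) (h : IsCutoff θ r M m χ) (hT : T < 0)
    {g : Pt → ℝ} (hgs : ContDiff ℝ ∞ g) (hg : ∀ ζ : Pt, T ≤ ζ.2.2 → g ζ = 0) :
    ContDiff ℝ ∞ fun ζ => cutoff θ r χ ζ * g ζ := by
  rw [contDiff_iff_contDiffAt]
  intro ζ
  rcases lt_or_ge ζ.2.2 0 with h1 | h1
  · exact (contDiffAt_cutoff hθ hr h h1).mul hgs.contDiffAt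
  · have h2 : ∀ᶠ z : Pt in 𝓝 ζ, T < z.2.2 :=
      (by fun_prop : Continuous fun ζ : Pt => ζ.2.2).continuousAt.eventually
        (Ioi_mem_nhds (hT.trans_le h1))
    refine (contDiffAt_const (c := (0 : ℝ))).congr_of_eventuallyEq (h2.mono fun z hz => ?_)
    simp only [hg z hz.le, mul_zero]

lemma isTest_of_zero_off {Ω K : Set Pt} (hK : IsCompact K) (hKΩ : K ⊆ Ω) {ψ : Pt → ℝ}
    (hs : ContDiff ℝ ∞ ψ) (h0 : ∀ ζ ∉ K, ψ ζ = 0) : IsTest Ω ψ := by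
  have h1 : tsupport ψ ⊆ K := closure_minimal (fun ζ hζ => by
    by_contra h2
    exact hζ (h0 ζ h2)) hK.isClosed
  exact ⟨hs, hK.of_isClosed_subset (isClosed_tsupport ψ) h1, h1.trans hKΩ⟩

lemma derivs_zero_off {K : Set Pt} (hK : IsCompact K) {ψ : Pt → ℝ} (h0 : ∀ ζ ∉ K, ψ ζ = 0)
    {ζ : Pt} (hζ : ζ ∉ K) : dX ψ ζ = 0 ∧ dY ψ ζ = 0 ∧ dT ψ ζ = 0 := by
  have h1 : ψ =ᶠ[𝓝 ζ] fun _ => 0 := by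
    filter_upwards [hK.isClosed.isOpen_compl.mem_nhds hζ] with z hz using h0 z hz
  refine ⟨?_, ?_, ?_⟩
  · rw [dX_congr h1]; simp [dX]
  · rw [dY_congr h1]; simp [dY]
  · rw [dT_congr h1]; simp [dT]

lemma integrable_mul_of_zero_off {K : Set Pt} (hK : IsCompact K) {u ψ : Pt → ℝ}
    (hu : IntegrableOn u K) (hψ : Continuous ψ) (h0 : ∀ ζ ∉ K, ψ ζ = 0) :
    Integrable fun ζ => u ζ * ψ ζ := by
  rw [← integrableOn_iff_integrable_of_support_subset (s := K)]
  · exact hu.mul_continuousOn hψ.continuousOn hK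
  · intro ζ hζ
    by_contra h1
    exact hζ (by simp only [h0 ζ h1, mul_zero])

lemma LpLoc.integrableOn {Ω K : Set Pt} (h : LpLoc 2 Ω wy) (hK : IsCompact K) (hKΩ : K ⊆ Ω) :
    IntegrableOn wy K := by
  have : IsFiniteMeasure (volume.restrict K) := ⟨by
    rw [Measure.restrict_apply_univ]; exact hK.measure_lt_top⟩
  exact (h K hK hKΩ).integrable (by norm_num)

lemma LpLoc.aestronglyMeasurable {Ω : Set Pt} (h : LpLoc 2 Ω wy) (hΩ : IsOpen Ω) :
    AEStronglyMeasurable wy (volume.restrict Ω) :=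
  ((locallyIntegrableOn_iff hΩ.isLocallyClosed).2
    fun _ hk hK => h.integrableOn hK hk).aestronglyMeasurable

/-- The integrand of the regularized `I₁`. -/
def sourceTerm (θ r : ℝ) (χ : ℝ → ℝ) (z ζ : Pt) : ℝ :=
  dY (cutoff θ r χ) ζ * kolDY z ζ +
    Γ₀ z ζ * (dT (cutoff θ r χ) ζ + ζ.2.1 * dX (cutoff θ r χ) ζ)

/-- The error integrand of the representation formula. -/
def errorTerm (θ r : ℝ) (χ : ℝ → ℝ) (a wy : Pt → ℝ) (ε : ℝ) (z ζ : Pt) : ℝ :=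
  wy ζ * (cutoff θ r χ ζ * dY (regKernel ε z) ζ)
    - a ζ * dY (fun ζ => cutoff θ r χ ζ * regKernel ε z ζ) ζ * wy ζ

/-- The second-order term is kept as `∂_η(φ ∂_ηG)`, the form on which the weak derivative of `w`
acts. Hence `∂_ηφ ∂_ηG` appears exactly once, as in `I₁`. -/
lemma transport_identity (hθ : 0 < θ) (hr : 0 < r) (h : IsCutoff θ r M m χ) {ε : ℝ} (hε : 0 < ε)
    (z : Pt) {ζ : Pt} (hζ : ζ.2.2 < 0) :
    dT (fun ζ => cutoff θ r χ ζ * regKernel ε z ζ) ζ +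
      ζ.2.1 * dX (fun ζ => cutoff θ r χ ζ * regKernel ε z ζ) ζ +
      dY (fun ζ => cutoff θ r χ ζ * dY (regKernel ε z) ζ) ζ =
    ramp ε (z.2.2 - ζ.2.2) * sourceTerm θ r χ z ζ -
      cutoff θ r χ ζ * (Γ₀ z ζ * deriv (ramp ε) (z.2.2 - ζ.2.2)) := by
  have hc : DifferentiableAt ℝ (cutoff θ r χ) ζ :=
    (contDiffAt_cutoff hθ hr h hζ).differentiableAt (by simp)
  have hG := contDiff_regKernel hε z
  have hG1 : DifferentiableAt ℝ (regKernel ε z) ζ := hG.differentiable (by simp) ζ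
  have hG2 : DifferentiableAt ℝ (dY (regKernel ε z)) ζ :=
    (contDiff_dY hG).differentiable (by simp) ζ
  have hadj := regKernel_adjoint hε z ζ
  rw [dT_mul hc hG1, dX_mul hc hG1, dY_mul hc hG2]
  have e1 : dY (regKernel ε z) ζ = ramp ε (z.2.2 - ζ.2.2) * kolDY z ζ := dY_regKernel ε z ζ
  have e2 : regKernel ε z ζ = ramp ε (z.2.2 - ζ.2.2) * Γ₀ z ζ := rfl
  rw [sourceTerm, e1, e2]
  linear_combination (cutoff θ r χ ζ) * hadj

lemma regKernel_of_le (ε : ℝ) {z ζ : Pt} (h : z.2.2 ≤ ζ.2.2) : regKernel ε z ζ = 0 := by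
  rw [regKernel, Γ₀_of_le h, mul_zero]

lemma dY_regKernel_of_le (ε : ℝ) {z ζ : Pt} (h : z.2.2 ≤ ζ.2.2) : dY (regKernel ε z) ζ = 0 := by
  rw [dY_regKernel, kolDY_of_le h, mul_zero]

/-- Continuity of the kernel weighted with the derivative of the time ramp. -/
lemma contDiff_Γ₀_mul_deriv_ramp {ε : ℝ} (hε : 0 < ε) (z : Pt) :
    ContDiff ℝ ∞ fun ζ => Γ₀ z ζ * deriv (ramp ε) (z.2.2 - ζ.2.2) := by
  have hG := contDiff_regKernel hε z
  have h1 : (fun ζ => Γ₀ z ζ * deriv (ramp ε) (z.2.2 - ζ.2.2)) = fun ζ : Pt =>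
      - (dT (regKernel ε z) ζ + ζ.2.1 * dX (regKernel ε z) ζ + dY (dY (regKernel ε z)) ζ) := by
    funext ζ
    rw [regKernel_adjoint hε, neg_neg]
  rw [h1]
  exact (((contDiff_dT hG).add ((by fun_prop : ContDiff ℝ ∞ fun ζ : Pt => ζ.2.1).mul
    (contDiff_dX hG))).add (contDiff_dY (contDiff_dY hG))).neg

/-- The weak formulation tested with the cut-off regularized kernel. -/
lemma regularized_representation (hθ : 0 < θ) (hθ1 : θ < 1) (hr : 0 < r)
    (hrθ : r < θ) (h : IsCutoff θ r M m χ)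
    (ha : AEStronglyMeasurable a (volume.restrict (Bminus 1)))
    (haΛ : ∀ᵐ z ∂(volume.restrict (Bminus 1)), |a z| ≤ Λ)
    (hw : IsWeakSubsolution a (Bminus 1) w wy) {ε : ℝ} (hε : 0 < ε) {z : Pt} (hz : z.2.2 < 0) :
    IntegrableOn (fun ζ => w ζ * (cutoff θ r χ ζ *
        (Γ₀ z ζ * deriv (ramp ε) (z.2.2 - ζ.2.2)))) (Bminus 1) ∧
    ∫ ζ in Bminus 1, w ζ * (cutoff θ r χ ζ * (Γ₀ z ζ * deriv (ramp ε) (z.2.2 - ζ.2.2))) ≤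
      (∫ ζ in Bminus 1, w ζ * (ramp ε (z.2.2 - ζ.2.2) * sourceTerm θ r χ z ζ)) +
      ∫ ζ in Bminus 1, errorTerm θ r χ a wy ε z ζ := by
  set K := pastBox θ r z.2.2
  have hK : IsCompact K := isCompact_pastBox _ _ _
  have hKΩ : K ⊆ Bminus 1 := pastBox_subset hθ hθ1 hr hrθ hz
  have hΩ : MeasurableSet (Bminus 1) := (isOpen_Bminus 1).measurableSet
  have hG := contDiff_regKernel hε z
  have hG0 : ∀ ζ : Pt, z.2.2 ≤ ζ.2.2 → regKernel ε z ζ = 0 := fun ζ h1 => regKernel_of_le ε h1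
  have hY0 : ∀ ζ : Pt, z.2.2 ≤ ζ.2.2 → dY (regKernel ε z) ζ = 0 :=
    fun ζ h1 => dY_regKernel_of_le ε h1
  have hD0 : ∀ ζ : Pt, z.2.2 ≤ ζ.2.2 → Γ₀ z ζ * deriv (ramp ε) (z.2.2 - ζ.2.2) = 0 :=
    fun ζ h1 => by rw [Γ₀_of_le h1, zero_mul]
  set ψ : Pt → ℝ := fun ζ => cutoff θ r χ ζ * regKernel ε z ζ with hψ
  set ψ₂ : Pt → ℝ := fun ζ => cutoff θ r χ ζ * dY (regKernel ε z) ζ with hψ₂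
  have cψ : ContDiff ℝ ∞ ψ := contDiff_cutoff_mul hθ hr h hz hG hG0
  have cψ₂ : ContDiff ℝ ∞ ψ₂ := contDiff_cutoff_mul hθ hr h hz (contDiff_dY hG) hY0
  have zψ : ∀ ζ ∉ K, ψ ζ = 0 := fun ζ hζ => cutoff_mul_eq_zero hθ hr h hz hG0 hζ
  have zψ₂ : ∀ ζ ∉ K, ψ₂ ζ = 0 := fun ζ hζ => cutoff_mul_eq_zero hθ hr h hz hY0 hζ
  have tψ : IsTest (Bminus 1) ψ := isTest_of_zero_off hK hKΩ cψ zψ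
  have tψ₂ : IsTest (Bminus 1) ψ₂ := isTest_of_zero_off hK hKΩ cψ₂ zψ₂
  have pψ : ∀ ζ, 0 ≤ ψ ζ := by
    intro ζ
    rcases lt_or_ge ζ.2.2 0 with h1 | h1
    · exact mul_nonneg (cutoff_mem_Icc hθ hr h h1).1 (regKernel_nonneg _ _ _)
    · simp only [hψ, hG0 ζ (hz.le.trans h1), mul_zero, le_refl]
  have wK : IntegrableOn w K := hw.transport_mem.1.1.mono_set hKΩ
  have wyK : IntegrableOn wy K := hw.dy_L2loc.integrableOn hK hKΩ
  have awyK : IntegrableOn (fun ζ => a ζ * wy ζ) K :=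
    Integrable.bdd_mul (c := Λ) wyK (ha.mono_measure (Measure.restrict_mono hKΩ le_rfl))
      (ae_mono (Measure.restrict_mono hKΩ le_rfl) haΛ)
  have i1 : Integrable fun ζ => w ζ * (dT ψ ζ + ζ.2.1 * dX ψ ζ) :=
    integrable_mul_of_zero_off hK wK
      ((contDiff_dT cψ).continuous.add ((by fun_prop : Continuous fun ζ : Pt => ζ.2.1).mul
        (contDiff_dX cψ).continuous)) fun ζ hζ => by
        obtain ⟨e1, -, e2⟩ := derivs_zero_off hK zψ hζ
        rw [e1, e2, mul_zero, add_zero]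
  have i2 : Integrable fun ζ => w ζ * dY ψ₂ ζ :=
    integrable_mul_of_zero_off hK wK (contDiff_dY cψ₂).continuous
      fun ζ hζ => (derivs_zero_off hK zψ₂ hζ).2.1
  have i3 : Integrable fun ζ => wy ζ * ψ₂ ζ :=
    integrable_mul_of_zero_off hK wyK cψ₂.continuous zψ₂
  have i4 : Integrable fun ζ => a ζ * dY ψ ζ * wy ζ := by
    refine (integrable_mul_of_zero_off hK awyK (contDiff_dY cψ).continuous
      fun ζ hζ => (derivs_zero_off hK zψ hζ).2.1).congr (Eventually.of_forall fun ζ => ?_)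
    simp only
    ring
  have i5 : Integrable fun ζ => w ζ * (cutoff θ r χ ζ *
      (Γ₀ z ζ * deriv (ramp ε) (z.2.2 - ζ.2.2))) :=
    integrable_mul_of_zero_off hK wK
      (contDiff_cutoff_mul hθ hr h hz (contDiff_Γ₀_mul_deriv_ramp hε z) hD0).continuous
      fun ζ hζ => cutoff_mul_eq_zero hθ hr h hz hD0 hζ
  refine ⟨i5.integrableOn, ?_⟩
  -- The subsolution inequality, tested with `ψ`, handles transport and the coefficient `a`; the
  -- weak derivative, tested with `ψ₂`, supplies the second-order term with coefficient one needed
  -- for the adjoint equation.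
  have hineq := hw.ineq ψ tψ pψ
  have hweak := hw.weakDY ψ₂ tψ₂
  have hid : ∫ ζ in Bminus 1, w ζ * (ramp ε (z.2.2 - ζ.2.2) * sourceTerm θ r χ z ζ) =
      (∫ ζ in Bminus 1, w ζ * (dT ψ ζ + ζ.2.1 * dX ψ ζ)) + (∫ ζ in Bminus 1, w ζ * dY ψ₂ ζ) +
      ∫ ζ in Bminus 1, w ζ * (cutoff θ r χ ζ *
        (Γ₀ z ζ * deriv (ramp ε) (z.2.2 - ζ.2.2))) := by
    have i12 : Integrable fun ζ => w ζ * (dT ψ ζ + ζ.2.1 * dX ψ ζ) + w ζ * dY ψ₂ ζ := i1.add i2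
    rw [← integral_add i1.integrableOn i2.integrableOn,
      ← integral_add i12.integrableOn i5.integrableOn]
    refine setIntegral_congr_fun hΩ fun ζ hζ => ?_
    have e := transport_identity hθ hr h hε z (ζ := ζ) hζ.2.2.2
    linear_combination (-(w ζ)) * e
  have herr : ∫ ζ in Bminus 1, errorTerm θ r χ a wy ε z ζ =
      (∫ ζ in Bminus 1, wy ζ * ψ₂ ζ) - ∫ ζ in Bminus 1, a ζ * dY ψ ζ * wy ζ :=
    integral_sub i3.integrableOn i4.integrableOn
  rw [hid, herr]
  simp only [transport] at hineq
  linarith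

/-- The bound is uniform in `ε` because the ramp lies between zero and one. The support of the
cut-off confines the elapsed time to `r²` and the point `ζ` to `Bminus (r / θ)`. -/
lemma enorm_errorTerm_le (hθ : 0 < θ) (hθ' : θ < (2 : ℝ)⁻¹ ^ 6) (hr : 0 < r)
    (h : IsCutoff θ r M m χ) {ε : ℝ} (hε : 0 < ε) {z ζ : Pt} (hz : z.2.2 < 0) (hζ : ζ.2.2 < 0)
    (haΛ : |a ζ| ≤ Λ) :
    ‖errorTerm θ r χ a wy ε z ζ‖ₑ ≤ (slab 0 (r ^ 2) z).indicator (fun ζ =>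
      (ENNReal.ofReal (1 + Λ) * ‖kolDY z ζ‖ₑ + ENNReal.ofReal (4 * Λ * θ / r) * ‖Γ₀ z ζ‖ₑ) *
        (Bminus (r / θ)).indicator (fun ζ => ‖wy ζ‖ₑ) ζ) ζ := by
  have hθ1 : θ < 1 := hθ'.trans_le (by norm_num)
  have hΛ : 0 ≤ Λ := (abs_nonneg _).trans haΛ
  have hc : DifferentiableAt ℝ (cutoff θ r χ) ζ :=
    (contDiffAt_cutoff hθ hr h hζ).differentiableAt (by simp)
  have hG1 : DifferentiableAt ℝ (regKernel ε z) ζ :=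
    (contDiff_regKernel hε z).differentiable (by simp) ζ
  rw [errorTerm, dY_mul hc hG1]
  by_cases h0 : cutoff θ r χ ζ = 0
  · rw [h0, dY_eq_zero_of_isLocalMin (isLocalMin_cutoff hθ hr h hζ h0)]
    simp
  rcases le_or_gt z.2.2 ζ.2.2 with h1 | h1
  · rw [regKernel_of_le ε h1, dY_regKernel_of_le ε h1]
    simp
  have hs : ζ ∈ slab 0 (r ^ 2) z := by
    have := (cutoff_support hθ hr h hζ h0).2.2
    exact ⟨by linarith, by linarith⟩
  rw [Set.indicator_of_mem hs,
    Set.indicator_of_mem (mem_Bminus_of_cutoff_ne_zero hθ hθ1 hr h hζ h0), dY_regKernel, regKernel]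
  simp only [Real.enorm_eq_ofReal_abs]
  rw [← ENNReal.ofReal_mul (by linarith), ← ENNReal.ofReal_mul (by positivity),
    ← ENNReal.ofReal_add (by positivity) (by positivity), ← ENNReal.ofReal_mul (by positivity)]
  refine ENNReal.ofReal_le_ofReal ?_
  have hφ := cutoff_mem_Icc hθ hr h hζ
  have hη := ramp_nonneg ε (z.2.2 - ζ.2.2)
  have hη1 := ramp_le_one ε (z.2.2 - ζ.2.2)
  have hd := abs_dY_cutoff_le hθ hθ' hr h hζ
  set φ := cutoff θ r χ ζ
  set η := ramp ε (z.2.2 - ζ.2.2)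
  set D := dY (cutoff θ r χ) ζ
  set k := kolDY z ζ
  set G := Γ₀ z ζ
  have hφη : |φ * η| ≤ 1 := by
    rw [abs_of_nonneg (mul_nonneg hφ.1 hη)]
    exact mul_le_one₀ hφ.2 hη hη1
  -- The two terms with `∂_ηΓ₀` combine into the factor `1 - a`; the other term carries the
  -- derivative of the cut-off.
  have e : wy ζ * (φ * (η * k)) - a ζ * (D * (η * G) + φ * (η * k)) * wy ζ
      = (φ * η) * ((1 - a ζ) * k) * wy ζ - (a ζ * D) * η * G * wy ζ := by ring
  have ha1 : |1 - a ζ| ≤ 1 + Λ := (abs_sub _ _).trans (by rw [abs_one]; linarith)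
  have b1 : |(φ * η) * ((1 - a ζ) * k) * wy ζ| ≤ 1 * ((1 + Λ) * |k|) * |wy ζ| := by
    rw [abs_mul, abs_mul, abs_mul (1 - a ζ)]
    gcongr
  have b2 : |(a ζ * D) * η * G * wy ζ| ≤ (Λ * (4 * θ / r)) * 1 * |G| * |wy ζ| := by
    rw [abs_mul, abs_mul, abs_mul, abs_mul, abs_of_nonneg hη]
    gcongr
  rw [e]
  refine (abs_sub _ _).trans ((add_le_add b1 b2).trans_eq ?_)
  ring

lemma enorm_integral_errorTerm_le (hθ : 0 < θ) (hθ' : θ < (2 : ℝ)⁻¹ ^ 6) (hr : 0 < r)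
    (h : IsCutoff θ r M m χ) (haΛ : ∀ᵐ z ∂(volume.restrict (Bminus 1)), |a z| ≤ Λ)
    {ε : ℝ} (hε : 0 < ε) {z : Pt} (hz : z.2.2 < 0) :
    ‖∫ ζ in Bminus 1, errorTerm θ r χ a wy ε z ζ‖ₑ ≤ potential (1 + Λ) (4 * Λ * θ / r) r
      ((Bminus (r / θ)).indicator fun ζ => ‖wy ζ‖ₑ) z := by
  refine (enorm_integral_le_lintegral_enorm _).trans ?_
  rw [potential, ← lintegral_indicator (measurableSet_slab _ _ _)]
  refine le_trans ?_ (lintegral_mono' (Measure.restrict_le_self (s := Bminus 1)) le_rfl)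
  refine lintegral_mono_ae ?_
  filter_upwards [haΛ, ae_restrict_mem (isOpen_Bminus 1).measurableSet] with ζ h1 h2
  exact enorm_errorTerm_le hθ hθ' hr h hε hz h2.2.2.2 h1

/-- The weight has unit mass, so `f z` can be brought under the integral and compared pointwise with
`f ζ`. -/
lemma ofReal_sub_integral_le_mollifyError {f : Pt → ℝ} (hf : Measurable f) {ε : ℝ} (hε : 0 < ε)
    (z : Pt) (hi : Integrable fun ζ => f ζ * (Γ₀ z ζ * deriv (ramp ε) (z.2.2 - ζ.2.2))) :
    ENNReal.ofReal (f z - ∫ ζ, f ζ * (Γ₀ z ζ * deriv (ramp ε) (z.2.2 - ζ.2.2)))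
      ≤ mollifyError f ε z := by
  have hk0 : ∀ ζ, 0 ≤ Γ₀ z ζ * deriv (ramp ε) (z.2.2 - ζ.2.2) := fun ζ =>
    mul_nonneg (Γ₀_nonneg _ _) (deriv_ramp_nonneg hε _)
  have hkm : Measurable fun ζ : Pt => Γ₀ z ζ * deriv (ramp ε) (z.2.2 - ζ.2.2) :=
    (contDiff_Γ₀_mul_deriv_ramp hε z).continuous.measurable
  have hone := lintegral_Γ₀_deriv_ramp_one hε z
  have hki : Integrable fun ζ => Γ₀ z ζ * deriv (ramp ε) (z.2.2 - ζ.2.2) := by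
    refine ⟨hkm.aestronglyMeasurable, ?_⟩
    rw [hasFiniteIntegral_iff_ofReal (Eventually.of_forall hk0), hone]
    exact ENNReal.one_lt_top
  have hint : ∫ ζ, Γ₀ z ζ * deriv (ramp ε) (z.2.2 - ζ.2.2) = 1 := by
    rw [integral_eq_lintegral_of_nonneg_ae (Eventually.of_forall hk0) hkm.aestronglyMeasurable,
      hone, ENNReal.toReal_one]
  have e1 : f z - ∫ ζ, f ζ * (Γ₀ z ζ * deriv (ramp ε) (z.2.2 - ζ.2.2))
      = ∫ ζ, (Γ₀ z ζ * deriv (ramp ε) (z.2.2 - ζ.2.2)) * (f z - f ζ) := by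
    have : ∫ ζ, f z * (Γ₀ z ζ * deriv (ramp ε) (z.2.2 - ζ.2.2)) = f z := by
      rw [integral_const_mul, hint, mul_one]
    nth_rewrite 1 [← this]
    rw [← integral_sub (hki.const_mul _) hi]
    refine integral_congr_ae (Eventually.of_forall fun ζ => ?_)
    simp only
    ring
  have hFm : Measurable fun ζ => ‖f ζ - f z‖ₑ := (hf.sub measurable_const).enorm
  calc ENNReal.ofReal (f z - ∫ ζ, f ζ * (Γ₀ z ζ * deriv (ramp ε) (z.2.2 - ζ.2.2)))
      ≤ ‖∫ ζ, (Γ₀ z ζ * deriv (ramp ε) (z.2.2 - ζ.2.2)) * (f z - f ζ)‖ₑ := by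
        rw [e1, Real.enorm_eq_ofReal_abs]
        exact ENNReal.ofReal_le_ofReal (le_abs_self _)
    _ ≤ ∫⁻ ζ, ‖(Γ₀ z ζ * deriv (ramp ε) (z.2.2 - ζ.2.2)) * (f z - f ζ)‖ₑ :=
        enorm_integral_le_lintegral_enorm _
    _ = ∫⁻ ζ, ENNReal.ofReal (Γ₀ z ζ * deriv (ramp ε) (z.2.2 - ζ.2.2)) * ‖f ζ - f z‖ₑ := by
        refine lintegral_congr fun ζ => ?_
        rw [enorm_mul, Real.enorm_eq_ofReal (hk0 ζ), enorm_sub_rev]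
    _ = mollifyError f ε z := lintegral_Γ₀_deriv_ramp hε hFm z

end Localization

/-! ### Removal of the regularization. -/

section Limit

variable {θ r M Λ T : ℝ} {m : ℝ → ℝ → ℝ} {χ : ℝ → ℝ} {a w wy : Pt → ℝ}

lemma integrableOn_pastBox {k : Pt → ℝ} (hk : Measurable k) {z : Pt} (hz : z.2.2 < 0)
    (h0 : ∀ ζ : Pt, z.2.2 ≤ ζ.2.2 → k ζ = 0) (hfin : ∫⁻ ζ in slab 0 (r ^ 2) z, ‖k ζ‖ₑ < ⊤) :
    IntegrableOn k (pastBox θ r z.2.2) := by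
  refine ⟨hk.aestronglyMeasurable, ?_⟩
  refine lt_of_le_of_lt ?_ hfin
  rw [← lintegral_indicator (isCompact_pastBox θ r z.2.2).measurableSet,
    ← lintegral_indicator (measurableSet_slab _ _ _)]
  refine lintegral_mono fun ζ => ?_
  refine Set.indicator_apply_le fun hζ => ?_
  rcases le_or_gt z.2.2 ζ.2.2 with h1 | h1
  · rw [h0 ζ h1, enorm_zero]; exact zero_le
  · have h2 : ζ ∈ slab 0 (r ^ 2) z := by
      have h3 : -r ^ 2 ≤ ζ.2.2 := hζ.1.2.2.1
      exact ⟨by linarith, by linarith⟩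
    rw [Set.indicator_of_mem h2]

/-- Integrability on the past box of a singular kernel times a continuous factor times a locally
bounded function. -/
lemma integrableOn_pastBox_mul (hθ : 0 < θ) (hθ1 : θ < 1) (hr : 0 < r) (hrθ : r < θ)
    (hw : LpLoc ⊤ (Bminus 1) w) {k d : Pt → ℝ} {z : Pt} (hz : z.2.2 < 0)
    (hk : IntegrableOn k (pastBox θ r z.2.2))
    (hd : ∀ ζ : Pt, ζ.2.2 < 0 → ContinuousAt d ζ) :
    IntegrableOn (fun ζ => w ζ * (k ζ * d ζ)) (pastBox θ r z.2.2) := by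
  have hK := isCompact_pastBox θ r z.2.2
  have hKΩ := pastBox_subset hθ hθ1 hr hrθ hz
  have h1 : IntegrableOn (fun ζ => k ζ * d ζ) (pastBox θ r z.2.2) :=
    hk.mul_continuousOn (fun ζ hζ => (hd ζ (hKΩ hζ).2.2.2).continuousWithinAt) hK
  -- The kernels are only used as `L¹` functions, so local boundedness of `w` is what makes the
  -- product integrable.
  exact h1.mul_of_top_right (hw _ hK hKΩ)

lemma dX_dY_dT_cutoff_of_eq_zero (hθ : 0 < θ) (hr : 0 < r) (h : IsCutoff θ r M m χ) {ζ : Pt}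
    (hζ : ζ.2.2 < 0) (h0 : cutoff θ r χ ζ = 0) :
    dX (cutoff θ r χ) ζ = 0 ∧ dY (cutoff θ r χ) ζ = 0 ∧ dT (cutoff θ r χ) ζ = 0 := by
  have hm := isLocalMin_cutoff hθ hr h hζ h0
  exact ⟨dX_eq_zero_of_isLocalMin hm, dY_eq_zero_of_isLocalMin hm, dT_eq_zero_of_isLocalMin hm⟩

lemma cutoff_eq_zero_or_of_notMem_pastBox (hθ : 0 < θ) (hr : 0 < r) (h : IsCutoff θ r M m χ)
    {z ζ : Pt} (hζ : ζ.2.2 < 0) (hn : ζ ∉ pastBox θ r z.2.2) :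
    cutoff θ r χ ζ = 0 ∨ z.2.2 ≤ ζ.2.2 := by
  by_contra! h1
  refine hn ⟨?_, h1.2.le⟩
  by_contra h2
  exact h1.1 (cutoff_eq_zero_of_notMem hθ hr h hζ h2)

/-- The two integrals defining `I₁` converge on all of `Bminus 1`. -/
lemma integrableOn_source (hθ : 0 < θ) (hθ1 : θ < 1) (hr : 0 < r) (hrθ : r < θ)
    (h : IsCutoff θ r M m χ) (hw : LpLoc ⊤ (Bminus 1) w) {z : Pt} (hz : z.2.2 < 0) :
    IntegrableOn (fun ζ => w ζ * (kolDY z ζ * dY (cutoff θ r χ) ζ)) (Bminus 1) ∧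
    IntegrableOn (fun ζ => w ζ * (Γ₀ z ζ *
      (dT (cutoff θ r χ) ζ + ζ.2.1 * dX (cutoff θ r χ) ζ))) (Bminus 1) := by
  have hΩ : MeasurableSet (Bminus 1) := (isOpen_Bminus 1).measurableSet
  constructor
  · refine IntegrableOn.of_forall_sdiff_eq_zero (integrableOn_pastBox_mul hθ hθ1 hr hrθ hw hz
      (integrableOn_pastBox (measurable_kolDY_right z) hz (fun ζ h1 => kolDY_of_le h1)
        (lintegral_slab_kolDY_lt_top (by positivity) z))
      fun ζ hζ => continuousAt_dY (contDiffAt_cutoff hθ hr h hζ)) hΩ fun ζ hζ => ?_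
    rcases cutoff_eq_zero_or_of_notMem_pastBox hθ hr h hζ.1.2.2.2 hζ.2 with h1 | h1
    · rw [(dX_dY_dT_cutoff_of_eq_zero hθ hr h hζ.1.2.2.2 h1).2.1, mul_zero, mul_zero]
    · rw [kolDY_of_le h1, zero_mul, mul_zero]
  · refine IntegrableOn.of_forall_sdiff_eq_zero (integrableOn_pastBox_mul hθ hθ1 hr hrθ hw hz
      (integrableOn_pastBox (measurable_Γ₀_right z) hz (fun ζ h1 => Γ₀_of_le h1)
        (lintegral_slab_Γ₀_lt_top _ z))
      fun ζ hζ => (continuousAt_dT (contDiffAt_cutoff hθ hr h hζ)).add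
        ((by fun_prop : Continuous fun ζ : Pt => ζ.2.1).continuousAt.mul
          (continuousAt_dX (contDiffAt_cutoff hθ hr h hζ)))) hΩ fun ζ hζ => ?_
    rcases cutoff_eq_zero_or_of_notMem_pastBox hθ hr h hζ.1.2.2.2 hζ.2 with h1 | h1
    · obtain ⟨e1, -, e2⟩ := dX_dY_dT_cutoff_of_eq_zero hθ hr h hζ.1.2.2.2 h1
      rw [e1, e2, mul_zero, add_zero, mul_zero, mul_zero]
    · rw [Γ₀_of_le h1, zero_mul, mul_zero]

/-- Outside `Bminus (r / θ)` the cut-off vanishes, hence so do its derivatives, and enlarging the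
domain to `Bminus 1` changes nothing. -/
lemma integral_source_eq (hθ : 0 < θ) (hθ1 : θ < 1) (hr : 0 < r) (hrθ : r < θ)
    (h : IsCutoff θ r M m χ) (hw : LpLoc ⊤ (Bminus 1) w) {z : Pt} (hz : z.2.2 < 0) :
    ∫ ζ in Bminus 1, w ζ * sourceTerm θ r χ z ζ = I₁ θ r χ w z := by
  obtain ⟨h1, h2⟩ := integrableOn_source hθ hθ1 hr hrθ h hw hz
  have hΩ : MeasurableSet (Bminus 1) := (isOpen_Bminus 1).measurableSet
  have hD : Bminus (r / θ) ⊆ Bminus 1 :=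
    Bminus_subset (by positivity) ((div_le_one hθ).2 hrθ.le)
  have h0 : ∀ ζ ∈ Bminus 1 \ Bminus (r / θ), dX (cutoff θ r χ) ζ = 0 ∧
      dY (cutoff θ r χ) ζ = 0 ∧ dT (cutoff θ r χ) ζ = 0 := by
    intro ζ hζ
    refine dX_dY_dT_cutoff_of_eq_zero hθ hr h hζ.1.2.2.2 ?_
    by_contra h3
    exact hζ.2 (mem_Bminus_of_cutoff_ne_zero hθ hθ1 hr h hζ.1.2.2.2 h3)
  have e1 := setIntegral_eq_of_subset_of_forall_sdiff_eq_zero (μ := volume)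
    (f := fun ζ => w ζ * (kolDY z ζ * dY (cutoff θ r χ) ζ)) hΩ hD (fun ζ hζ => by
      simp only [(h0 ζ hζ).2.1, mul_zero])
  have e2 := setIntegral_eq_of_subset_of_forall_sdiff_eq_zero (μ := volume)
    (f := fun ζ => w ζ * (Γ₀ z ζ * (dT (cutoff θ r χ) ζ + ζ.2.1 * dX (cutoff θ r χ) ζ))) hΩ hD
    (fun ζ hζ => by simp only [(h0 ζ hζ).1, (h0 ζ hζ).2.2, mul_zero, add_zero])
  have e3 : ∫ ζ in Bminus 1, w ζ * sourceTerm θ r χ z ζ =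
      (∫ ζ in Bminus 1, w ζ * (kolDY z ζ * dY (cutoff θ r χ) ζ)) +
      ∫ ζ in Bminus 1, w ζ * (Γ₀ z ζ *
        (dT (cutoff θ r χ) ζ + ζ.2.1 * dX (cutoff θ r χ) ζ)) := by
    rw [← integral_add h1 h2]
    refine integral_congr_ae (Eventually.of_forall fun ζ => ?_)
    simp only [sourceTerm]
    ring
  rw [e3, e1, e2, I₁]
  congr 1
  · refine integral_congr_ae (Eventually.of_forall fun ζ => ?_)
    simp only [dY_Γ₀]
    ring
  · refine integral_congr_ae (Eventually.of_forall fun ζ => ?_)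
    simp only
    ring

/-- Dominated convergence with the unregularized integrand as majorant: for `τ < t` the ramp is
eventually one, and for `τ ≥ t` the kernels are zero. -/
lemma tendsto_integral_source (hθ : 0 < θ) (hθ1 : θ < 1) (hr : 0 < r) (hrθ : r < θ)
    (h : IsCutoff θ r M m χ) (hw : LpLoc ⊤ (Bminus 1) w) {z : Pt} (hz : z.2.2 < 0) {e : ℕ → ℝ}
    (he : Tendsto e atTop (𝓝[>] 0)) :
    Tendsto (fun n => ∫ ζ in Bminus 1, w ζ * (ramp (e n) (z.2.2 - ζ.2.2) * sourceTerm θ r χ z ζ))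
      atTop (𝓝 (I₁ θ r χ w z)) := by
  obtain ⟨h1, h2⟩ := integrableOn_source hθ hθ1 hr hrθ h hw hz
  rw [← integral_source_eq hθ hθ1 hr hrθ h hw hz]
  have h3 : IntegrableOn (fun ζ => w ζ * sourceTerm θ r χ z ζ) (Bminus 1) :=
    (h1.add h2).congr (Eventually.of_forall fun ζ => by
      simp only [sourceTerm, Pi.add_apply]
      ring)
  refine tendsto_integral_of_dominated_convergence (fun ζ => ‖w ζ * sourceTerm θ r χ z ζ‖)
    (fun n => ?_) h3.norm (fun n => Eventually.of_forall fun ζ => ?_)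
    (Eventually.of_forall fun ζ => ?_)
  · refine ((contDiff_timeRamp (e n) z).continuous.aestronglyMeasurable.mul
      h3.aestronglyMeasurable).congr (Eventually.of_forall fun ζ => ?_)
    simp only [Pi.mul_apply]
    ring
  · have e1 : w ζ * (ramp (e n) (z.2.2 - ζ.2.2) * sourceTerm θ r χ z ζ)
        = ramp (e n) (z.2.2 - ζ.2.2) * (w ζ * sourceTerm θ r χ z ζ) := by ring
    rw [e1, norm_mul, Real.norm_of_nonneg (ramp_nonneg _ _)]
    exact mul_le_of_le_one_left (norm_nonneg _) (ramp_le_one _ _)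
  · rcases le_or_gt z.2.2 ζ.2.2 with h4 | h4
    · have e1 : sourceTerm θ r χ z ζ = 0 := by
        rw [sourceTerm, kolDY_of_le h4, Γ₀_of_le h4, mul_zero, zero_mul, add_zero]
      simp only [e1, mul_zero]
      exact tendsto_const_nhds
    · refine tendsto_const_nhds.congr' ?_
      have h5 : ∀ᶠ ε in 𝓝[>] (0 : ℝ), ε ∈ Set.Ioo 0 ((z.2.2 - ζ.2.2) / 2) :=
        Ioo_mem_nhdsGT (by linarith)
      filter_upwards [he.eventually h5] with n hn
      rw [ramp_of_ge hn.1 (by linarith [hn.2]), one_mul]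

lemma integrable_cutoff_mul (hθ : 0 < θ) (hr : 0 < r) (h : IsCutoff θ r M m χ)
    (hw : IntegrableOn w (Bminus 1)) :
    Integrable ((Bminus 1).indicator fun ζ => w ζ * cutoff θ r χ ζ) := by
  have hΩ : MeasurableSet (Bminus 1) := (isOpen_Bminus 1).measurableSet
  rw [integrable_indicator_iff hΩ]
  refine Integrable.mul_bdd (c := 1) hw ?_ ?_
  · refine ContinuousOn.aestronglyMeasurable (fun ζ hζ => ?_) hΩ
    exact (contDiffAt_cutoff hθ hr h hζ.2.2.2).continuousAt.continuousWithinAt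
  · filter_upwards [ae_restrict_mem hΩ] with ζ hζ
    have := cutoff_mem_Icc hθ hr h hζ.2.2.2
    rw [Real.norm_of_nonneg this.1]
    exact this.2

/-- The excess of a subsolution over `I₁` is bounded by the potential of `|∂_y w|`. -/
lemma ae_ofReal_sub_I₁_le (hθ : 0 < θ) (hθ' : θ < (2 : ℝ)⁻¹ ^ 6) (hr : 0 < r)
    (hrθ : r < θ) (h : IsCutoff θ r M m χ)
    (ha : AEStronglyMeasurable a (volume.restrict (Bminus 1)))
    (haΛ : ∀ᵐ z ∂(volume.restrict (Bminus 1)), |a z| ≤ Λ)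
    (hw : IsWeakSubsolution a (Bminus 1) w wy) :
    ∀ᵐ z, z ∈ Bminus (θ * r) → ENNReal.ofReal (w z - I₁ θ r χ w z) ≤
      potential (1 + Λ) (4 * Λ * θ / r) r ((Bminus (r / θ)).indicator fun ζ => ‖wy ζ‖ₑ) z := by
  have hθ1 : θ < 1 := hθ'.trans_le (by norm_num)
  have hΩ : MeasurableSet (Bminus 1) := (isOpen_Bminus 1).measurableSet
  have hfi := integrable_cutoff_mul hθ hr h hw.transport_mem.1.1
  set f := (Bminus 1).indicator fun ζ => w ζ * cutoff θ r χ ζ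
  -- The approximation argument uses joint measurability in `z` and the parameter, so a measurable
  -- representative replaces `w φ`.
  obtain ⟨f₀, hf₀, hff₀⟩ := hfi.aestronglyMeasurable.aemeasurable
  have hfi₀ : Integrable f₀ := hfi.congr hff₀
  let e : ℕ → ℝ := fun n => 1 / ((n : ℝ) + 1)
  have he0 : ∀ n, 0 < e n := fun n => by positivity
  have he : Tendsto e atTop (𝓝[>] 0) :=
    tendsto_nhdsWithin_iff.2 ⟨tendsto_one_div_add_atTop_nhds_zero_nat, Eventually.of_forall he0⟩
  filter_upwards [hff₀, ae_liminf_mollifyError hf₀ hfi₀ he] with z hz1 hz2 hzB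
  have hz : z.2.2 < 0 := hzB.2.2.2
  have hzΩ : z ∈ Bminus 1 := Bminus_subset (by positivity) (by nlinarith) hzB
  have hfz : f₀ z = w z := by
    rw [← hz1]
    simp only [f]
    rw [Set.indicator_of_mem hzΩ, cutoff_eq_one hθ hθ' hr h hzB, mul_one]
  set P := potential (1 + Λ) (4 * Λ * θ / r) r ((Bminus (r / θ)).indicator fun ζ => ‖wy ζ‖ₑ) z
  set J : ℕ → ℝ := fun n =>
    ∫ ζ in Bminus 1, w ζ * (ramp (e n) (z.2.2 - ζ.2.2) * sourceTerm θ r χ z ζ)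
  have hstep : ∀ n, ENNReal.ofReal (w z - J n) ≤ mollifyError f₀ (e n) z + P := by
    intro n
    obtain ⟨hi, hle⟩ := regularized_representation hθ hθ1 hr hrθ h ha haΛ hw (he0 n) hz
    have herr := enorm_integral_errorTerm_le (wy := wy) hθ hθ' hr h haΛ (he0 n) hz
    set k : Pt → ℝ := fun ζ => Γ₀ z ζ * deriv (ramp (e n)) (z.2.2 - ζ.2.2)
    have e1 : (Bminus 1).indicator (fun ζ => w ζ * (cutoff θ r χ ζ * k ζ)) = fun ζ => f ζ * k ζ := by
      funext ζ
      by_cases hζ : ζ ∈ Bminus 1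
      · simp only [f, Set.indicator_of_mem hζ, mul_assoc]
      · simp only [f, Set.indicator_of_notMem hζ, zero_mul]
    have e2 : (fun ζ => f ζ * k ζ) =ᵐ[volume] fun ζ => f₀ ζ * k ζ := by
      filter_upwards [hff₀] with ζ hζ
      rw [hζ]
    have hi1 : Integrable fun ζ => f ζ * k ζ := by
      rw [← e1]; exact (integrable_indicator_iff hΩ).2 hi
    have e3 : ∫ ζ in Bminus 1, w ζ * (cutoff θ r χ ζ * k ζ) = ∫ ζ, f₀ ζ * k ζ := by
      rw [← integral_indicator hΩ, e1, integral_congr_ae e2]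
    have hmol := ofReal_sub_integral_le_mollifyError hf₀ (he0 n) z (hi1.congr e2)
    set E := ∫ ζ in Bminus 1, errorTerm θ r χ a wy (e n) z ζ
    have hle2 : w z - J n ≤ (f₀ z - ∫ ζ, f₀ ζ * k ζ) + E := by
      rw [hfz, ← e3]
      linarith
    calc ENNReal.ofReal (w z - J n)
        ≤ ENNReal.ofReal (f₀ z - ∫ ζ, f₀ ζ * k ζ) + ENNReal.ofReal E :=
          (ENNReal.ofReal_le_ofReal hle2).trans ENNReal.ofReal_add_le
      _ ≤ mollifyError f₀ (e n) z + P := by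
          refine add_le_add hmol (le_trans ?_ herr)
          rw [Real.enorm_eq_ofReal_abs]
          exact ENNReal.ofReal_le_ofReal (le_abs_self _)
  -- Subtracting `P` first isolates the mollification error, of which only the lower limit is known.
  -- Truncated subtraction also covers `P = ⊤`.
  have hlim : Tendsto (fun n => ENNReal.ofReal (w z - J n) - P) atTop
      (𝓝 (ENNReal.ofReal (w z - I₁ θ r χ w z) - P)) := by
    refine ENNReal.Tendsto.sub ?_ tendsto_const_nhds (Or.inl ENNReal.ofReal_ne_top)
    exact ENNReal.tendsto_ofReal (tendsto_const_nhds.sub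
      (tendsto_integral_source hθ hθ1 hr hrθ h hw.bounded_loc hz he))
  have hle : ENNReal.ofReal (w z - I₁ θ r χ w z) - P ≤ 0 := by
    rw [← hlim.liminf_eq, ← hz2]
    exact liminf_le_liminf (Eventually.of_forall fun n => tsub_le_iff_right.2 (hstep n))
  exact tsub_eq_zero_iff_le.1 (le_antisymm hle zero_le)

/-- Here `EReal.toENNReal` is the positive part. When `I₀ = ⊤` the difference is `⊥` and the left
side is zero, so no separate case arises. -/
lemma toENNReal_sub_I₀_le {z : Pt} (hz : z ∈ Bminus (θ * r)) :
    ((w z : EReal) - I₀ θ r χ w).toENNReal ≤ ENNReal.ofReal (w z - I₁ θ r χ w z) := by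
  have h1 : (I₁ θ r χ w z : EReal) ≤ I₀ θ r χ w :=
    le_iSup₂ (f := fun z (_ : z ∈ Bminus (θ * r)) => (I₁ θ r χ w z : EReal)) z hz
  rw [← EReal.real_coe_toENNReal, EReal.coe_sub]
  exact EReal.toENNReal_le_toENNReal (EReal.sub_le_sub le_rfl h1)

lemma potential_congr_ae {A κ : ℝ} {F G : Pt → ℝ≥0∞} (h : F =ᵐ[volume] G) (z : Pt) :
    potential A κ r F z = potential A κ r G z := by
  refine lintegral_congr_ae (ae_restrict_of_ae ?_)
  filter_upwards [h] with ζ hζ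
  rw [hζ]

end Limit

end UltraParabolic

end

/-! ### Conclusion. -/

theorem proposition4p5 (Λ : ℝ) (hΛ : 0 < Λ) :
    ∃ C : ℝ, 0 < C ∧
      ∀ θ : ℝ, 0 < θ → θ < (2 : ℝ)⁻¹ ^ 6 →
      ∀ r : ℝ, 0 < r → r < θ →
      ∀ (M : ℝ) (m : ℝ → ℝ → ℝ) (χ : ℝ → ℝ), UltraParabolic.IsCutoff θ r M m χ →
      ∀ a : UltraParabolic.Pt → ℝ,
        AEStronglyMeasurable a (volume.restrict (UltraParabolic.Bminus 1)) →
        (∀ᵐ z ∂(volume.restrict (UltraParabolic.Bminus 1)), Λ⁻¹ ≤ a z ∧ a z ≤ Λ) →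
      ∀ w wy : UltraParabolic.Pt → ℝ,
        UltraParabolic.IsWeakSubsolution a (UltraParabolic.Bminus 1) w wy →
        (∀ᵐ z ∂(volume.restrict (UltraParabolic.Bminus 1)), 0 ≤ w z) →
        ∫⁻ z in UltraParabolic.Bminus (θ * r),
            ((w z : EReal) - UltraParabolic.I₀ θ r χ w).toENNReal ^ 2 ≤
          ENNReal.ofReal (C * θ ^ 2 * r ^ 2) *
            ∫⁻ z in UltraParabolic.Bminus (r / θ), ENNReal.ofReal (wy z ^ 2) := by
  -- The constant is that of the potential estimate with `A = 1 + Λ` and `c = 4Λ`. The two moments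
  -- are finite absolute numbers, so only `Λ` enters.
  open UltraParabolic in
  refine ⟨3 * ((1 + Λ) ^ 2 * (4 * slopeMean.toReal ^ 2) +
    (1 + Λ) ^ 2 * (2 * slopeEnergy.toReal) + (4 * Λ) ^ 2), by positivity, ?_⟩
  intro θ hθ hθ' r hr hrθ M m χ hχ a ha haΛ w wy hw _
  have hθ1 : θ < 1 := hθ'.trans_le (by norm_num)
  have haΛ' : ∀ᵐ z ∂(volume.restrict (UltraParabolic.Bminus 1)), |a z| ≤ Λ := by
    filter_upwards [haΛ] with z hz
    rw [abs_of_pos (lt_of_lt_of_le (inv_pos.2 hΛ) hz.1)]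
    exact hz.2
  have hD : MeasurableSet (UltraParabolic.Bminus (r / θ)) :=
    (UltraParabolic.isOpen_Bminus _).measurableSet
  have hB : MeasurableSet (UltraParabolic.Bminus (θ * r)) :=
    (UltraParabolic.isOpen_Bminus _).measurableSet
  have hDΩ : UltraParabolic.Bminus (r / θ) ⊆ UltraParabolic.Bminus 1 :=
    UltraParabolic.Bminus_subset (by positivity) ((div_le_one hθ).2 hrθ.le)
  have hwy : AEMeasurable ((UltraParabolic.Bminus (r / θ)).indicator fun ζ => ‖wy ζ‖ₑ) := by
    rw [aemeasurable_indicator_iff hD]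
    exact ((hw.dy_L2loc.aestronglyMeasurable (UltraParabolic.isOpen_Bminus 1)).mono_measure
      (Measure.restrict_mono hDΩ le_rfl)).enorm
  obtain ⟨F, hF, hFe⟩ := hwy
  have hE : ∫⁻ z, F z ^ 2
      = ∫⁻ z in UltraParabolic.Bminus (r / θ), ENNReal.ofReal (wy z ^ 2) := by
    rw [← lintegral_indicator hD]
    refine lintegral_congr_ae ?_
    filter_upwards [hFe] with z hz
    rw [← hz]
    by_cases h : z ∈ UltraParabolic.Bminus (r / θ)
    · rw [Set.indicator_of_mem h, Set.indicator_of_mem h, Real.enorm_eq_ofReal_abs,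
        ← ENNReal.ofReal_pow (abs_nonneg _), sq_abs]
    · rw [Set.indicator_of_notMem h, Set.indicator_of_notMem h]
      simp
  have hmain := UltraParabolic.ae_ofReal_sub_I₁_le hθ hθ' hr hrθ hχ ha haΛ' hw
  calc ∫⁻ z in UltraParabolic.Bminus (θ * r),
        ((w z : EReal) - UltraParabolic.I₀ θ r χ w).toENNReal ^ 2
      ≤ ∫⁻ z in UltraParabolic.Bminus (θ * r),
        UltraParabolic.potential (1 + Λ) (4 * Λ * θ / r) r F z ^ 2 := by
        refine lintegral_mono_ae ((ae_restrict_iff' hB).2 ?_)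
        filter_upwards [hmain] with z hz hzB
        rw [← UltraParabolic.potential_congr_ae hFe]
        exact pow_le_pow_left₀ zero_le ((UltraParabolic.toENNReal_sub_I₀_le hzB).trans (hz hzB)) 2
    -- With `κ = 4Λθ/r` and `ρ = θ r` one has `κ r² = 4Λ ρ`, which fixes `c`.
    _ ≤ _ := UltraParabolic.lintegral_potential_sq_le (c := 4 * Λ) (by positivity) (by positivity)
        (mul_pos hθ hr) (by field_simp) (by positivity) hF
    _ = _ := by
        rw [hE]
        congr 2
        ring
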